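/- **Margin-based localization for bounded noise.** *Setting.* For a unit vector $w\in\mathbb R^d$ let $h_w(x)=\mathrm{sign}(w\cdot x)\in\{-1,+1\}$ (with $\mathrm{sign}(0)=+1$), and let $\theta(w,w')\in[0,\pi]$ be the angle between unit vectors. For a probability distribution $\mathcal D$ on $\mathbb R^d\times\{-1,+1\}$ let $\mathrm{err}_{\mathcal D}(h_w)=\Pr_{(x,y)\sim\mathcal D}[y\ne h_w(x)]$ and $\mathrm{opt}=\inf_{\|w\|=1}\mathrm{err}_{\mathcal D}(h_w)$, and let $\mathcal D_{w,\gamma}$ be $\mathcal D$ conditioned on the band $|w\cdot x|\le\gamma$. A distribution on $\mathbb R^d$ is isotropic log-concave if it has a density $p$ with $\log p$ concave (with values in $[-\infty,\infty)$), mean $0$ and identity covariance. $\mathcal D$ has $\nu$-bounded noise relative to the unit vector $w^*$ if $\nu<\frac12$ and $\mathbb E[y\,h_{w^*}(x)\mid x]\ge 1-2\nu$ almost surely. *Constants.* Call positive reals $\underline C_1,\overline C_1,\overline C_2,C_3'$ *valid* if for every $d$, every isotropic log-concave $\mathcal P$ on $\mathbb R^d$ and all unit vectors $w,w'$: - $\underline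 C_1\theta(w,w')\le\Pr_{\mathcal P}[h_w(x)\ne h_{w'}(x)]\le\overline C_1\theta(w,w')$; - $\Pr_{\mathcal P}[|x\cdot w|\le\gamma]\le\overline C_2\gamma$ for all $\gamma\ge0$; - $\Pr_{\mathcal P}[|x\cdot w|\ge C_3'\alpha,\ h_w(x)\ne h_{w'}(x)]\le\alpha\,\underline C_1/8$ whenever $\theta(w,w')\le\alpha<\pi/2$. Given such constants put $c_\gamma=\max\{C_3',\underline C_1/\overline C_2\}$, $c_0=\min\{\frac14,\frac{\underline C_1}{4\overline C_2C_3'}\}$, $\alpha_k=2^{-k}\pi$, $\gamma_k=\alpha_kc_\gamma$ and $r=\max\{0,\lceil\log_2(\overline C_1\pi/\epsilon)\rceil-1\}$. *Oracle and algorithm.* An in-band oracle $\mathcal O(w,\gamma,\alpha,\delta)$ is a (possibly randomized) procedure that takes $m(\gamma,\alpha,\delta)$ i.i.d. samples from $\mathcal D$ and returns a unit vector $w'$, depending measurably on $w$, the samples and its internal randomness. For a function $g$ (the error tolerance function), $\mathcal O$ *succeeds* on $\mathcal D$ with parameters $(\gamma,\alpha,\delta)$ if for every unit vector $w$ with $\theta(w,w^*)\le\alpha$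 and $\mathrm{err}_{\mathcal D_{w,\gamma}}(h_{w^*})\le g(c_0)$ the output satisfies $\theta(w',w)\le\alpha$ almost surely and, with probability at least $1-\delta$, $\Pr_{\mathcal D_{w,\gamma}}[h_{w'}(x)\ne h_{w^*}(x)]\le c_0$. The localization algorithm, given $\epsilon,\delta$, sample access to $\mathcal D$, $\mathcal O$, and a unit vector $w_1$ with $\theta(w_1,w^*)<\pi/2$, sets $w_{k+1}\leftarrow\mathcal O(w_k,\gamma_k,\alpha_k,\delta/r)$ for $k=1,\dots,r$, with fresh samples and randomness in each call, and returns $h_{w_{r+1}}$. *Statement.* Valid constants exist. For every choice of valid constants, every $d$, every $\mathcal D$ with isotropic log-concave marginal on $\mathbb R^d$ and $\nu$-bounded noise relative to $w^*$, every in-band oracle $\mathcal O$ and function $g$ with $\nu\le g(c_0)$, every unit vector $w_1$ with $\theta(w_1,w^*)<\pi/2$, every $\epsilon>0$ and every $\delta\in(0,1)$: if $\mathcal O$ succeeds on $\mathcal D$ with parameters $(\gamma_k,\alpha_k,\delta/r)$ for all $k=1,\dots,r$, then the localization algorithm takes exactly $$m=\sum_{k=1}^{r}m\left(\gamma_k,\alpha_k,\frac{\delta}{r}\right)$$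 samples from $\mathcal D$ and, with probability at least $1-\delta$, returns a halfspace $h_w$ with $\mathrm{err}_{\mathcal D}(h_w)\le\mathrm{opt}+\epsilon$. No relation between $\epsilon$ and $\mathrm{opt}$ is required. -/

import Mathlib

open MeasureTheory ProbabilityTheory InnerProductGeometry

noncomputable section

namespace Localization

/-- The instance space `ℝᵈ` with its Euclidean norm. -/
abbrev Inst (d : ℕ) : Type := EuclideanSpace ℝ (Fin d)

/-- The labels `{-1, +1}`. -/
abbrev Label : Type := {y : ℝ // y = 1 ∨ y = -1}

/-- Labelled instances. -/
abbrev Example (d : ℕ) : Type := Inst d × Label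

/-- Unit vectors of `ℝᵈ`. -/
abbrev UnitVec (d : ℕ) : Type := Metric.sphere (0 : Inst d) 1

/-- The angle `θ(w, w') ∈ [0, π]` between two unit vectors. -/
def theta {d : ℕ} (w w' : UnitVec d) : ℝ := angle (w : Inst d) (w' : Inst d)

/-- The homogeneous halfspace `h_w(x) = sign(w · x)`, with `sign 0 = +1`. -/
def halfspace {d : ℕ} (w : UnitVec d) (x : Inst d) : Label :=
  if 0 ≤ inner ℝ (w : Inst d) x then ⟨1, Or.inl rfl⟩ else ⟨-1, Or.inr rfl⟩

/-- `err_D(h_w) = Pr_{(x, y) ∼ D}[y ≠ h_w(x)]`. -/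
def err {d : ℕ} (D : Measure (Example d)) (w : UnitVec d) : ℝ :=
  D.real {p | p.2 ≠ halfspace w p.1}

/-- The least error of a homogeneous halfspace. -/
def opt {d : ℕ} (D : Measure (Example d)) : ℝ := ⨅ w : UnitVec d, err D w

/-- `Pr_{(x, y) ∼ D}[h_w(x) ≠ h_{w'}(x)]`. -/
def disagreement {d : ℕ} (D : Measure (Example d)) (w w' : UnitVec d) : ℝ :=
  D.real {p | halfspace w p.1 ≠ halfspace w' p.1}

/-- The distribution `D_{w, γ}`: `D` conditioned on the band `|w · x| ≤ γ`. -/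
def bandDist {d : ℕ} (D : Measure (Example d)) (w : UnitVec d) (γ : ℝ) : Measure (Example d) :=
  ProbabilityTheory.cond D {p | |inner ℝ (w : Inst d) p.1| ≤ γ}

/-- `P` has a density whose logarithm is concave, as a function with values in `[-∞, ∞)`:
the density is positive on a convex set and its logarithm is concave there. -/
def IsLogConcave {d : ℕ} (P : Measure (Inst d)) : Prop :=
  ∃ p : Inst d → ℝ, Measurable p ∧ (∀ x, 0 ≤ p x) ∧
    P = volume.withDensity (fun x => ENNReal.ofReal (p x)) ∧
    ConcaveOn ℝ {x | 0 < p x} (fun x => Real.log (p x))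

/-- Mean zero and identity covariance matrix. -/
def IsIsotropic {d : ℕ} (P : Measure (Inst d)) : Prop :=
  MemLp (fun x : Inst d => x) 2 P ∧
    (∀ i, ∫ x, x i ∂P = 0) ∧
    (∀ i j, ∫ x, x i * x j ∂P = if i = j then 1 else 0)

/-- An isotropic log-concave probability distribution on `ℝᵈ`. -/
structure IsIsotropicLogConcave {d : ℕ} (P : Measure (Inst d)) : Prop where
  isProbabilityMeasure : IsProbabilityMeasure P
  logConcave : IsLogConcave P
  isotropic : IsIsotropic P

/-- `D` has bounded noise with parameter `ν < 1/2` relative to the halfspace of `wstar`: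
`E[y h_{wstar}(x) | x] ≥ 1 - 2ν` for almost every `x`. -/
def HasBoundedNoise {d : ℕ} (D : Measure (Example d)) (wstar : UnitVec d) (ν : ℝ) : Prop :=
  ν < 1 / 2 ∧
    ∀ᵐ p ∂D, 1 - 2 * ν ≤
      (D[(fun q : Example d => (q.2 : ℝ) * (halfspace wstar q.1 : ℝ)) |
        MeasurableSpace.comap Prod.fst inferInstance]) p

/-- The angle bound `α_k = 2⁻ᵏ π`. -/
def αk (k : ℕ) : ℝ := (1 / 2 : ℝ) ^ k * Real.pi

/-- A choice of the constants that enter the algorithm: `C₁lo`, `C₁hi`, `C₂hi` and `C₃'`. -/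
structure Constants where
  C₁lo : ℝ
  C₁hi : ℝ
  C₂hi : ℝ
  C₃' : ℝ

/-- The constants are absolute constants (independent of dimension and distribution) which bound
disagreement probabilities by angles, the mass of bands by their width, and the part of the
disagreement outside the band; the last one belongs to `C₃ = C₁lo / 8`. -/
structure Constants.Valid (C : Constants) : Prop where
  C₁lo_pos : 0 < C.C₁lo
  C₁hi_pos : 0 < C.C₁hi
  C₂hi_pos : 0 < C.C₂hi
  C₃'_pos : 0 < C.C₃'
  angle_le : ∀ (d : ℕ) (P : Measure (Inst d)), IsIsotropicLogConcave P → ∀ w w' : UnitVec d,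
    C.C₁lo * theta w w' ≤ P.real {x | halfspace w x ≠ halfspace w' x}
  le_angle : ∀ (d : ℕ) (P : Measure (Inst d)), IsIsotropicLogConcave P → ∀ w w' : UnitVec d,
    P.real {x | halfspace w x ≠ halfspace w' x} ≤ C.C₁hi * theta w w'
  band_le : ∀ (d : ℕ) (P : Measure (Inst d)), IsIsotropicLogConcave P → ∀ w : UnitVec d,
    ∀ γ : ℝ, 0 ≤ γ → P.real {x | |inner ℝ x (w : Inst d)| ≤ γ} ≤ C.C₂hi * γ
  outside_le : ∀ (d : ℕ) (P : Measure (Inst d)), IsIsotropicLogConcave P → ∀ w w' : UnitVec d,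
    ∀ α : ℝ, theta w w' ≤ α → α < Real.pi / 2 →
      P.real {x | C.C₃' * α ≤ |inner ℝ x (w : Inst d)| ∧ halfspace w x ≠ halfspace w' x}
        ≤ α * (C.C₁lo / 8)

namespace Constants

/-- `c_γ = max {C₃', C₁lo / C₂hi}`. -/
def cγ (C : Constants) : ℝ := max C.C₃' (C.C₁lo / C.C₂hi)

/-- `c₀ = min {1/4, C₁lo / (4 C₂hi C₃')}`. -/
def c₀ (C : Constants) : ℝ := min (1 / 4) (C.C₁lo / (4 * C.C₂hi * C.C₃'))

/-- The band width `γ_k = α_k c_γ`. -/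
def γ (C : Constants) (k : ℕ) : ℝ := αk k * C.cγ

/-- The number of iterations `r = ⌈log₂ (C₁hi π / ε)⌉ - 1` (no iteration if this is negative). -/
def iterations (C : Constants) (ε : ℝ) : ℕ := ⌈Real.logb 2 (C.C₁hi * Real.pi / ε)⌉₊ - 1

end Constants

/-- An in-band oracle: a procedure with access to a distribution through examples only.
On input `(w, γ, α, δ)` it reads `numSamples γ α δ` examples and a uniform random seed from
`[0, 1]` (its internal randomness), and returns a unit vector. -/
structure Oracle (d : ℕ) where
  numSamples : ℝ → ℝ → ℝ → ℕ
  run : (w : UnitVec d) → (γ α δ : ℝ) → (Fin (numSamples γ α δ) → Example d) →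
    unitInterval → UnitVec d
  measurable_run : ∀ γ α δ : ℝ, Measurable
    (fun q : UnitVec d × (Fin (numSamples γ α δ) → Example d) × unitInterval =>
      run q.1 γ α δ q.2.1 q.2.2)

/-- The oracle succeeds on `D` and the parameters `(γ, α, δ)` with noise tolerance `tol` and
accuracy `c₀`: for each unit vector `w` with `θ(w, wstar) ≤ α` and
`err_{D_{w, γ}}(h_{wstar}) ≤ tol` it returns `w'` with `θ(w', w) ≤ α` and, with probability at
least `1 - δ` over i.i.d. examples from `D` and the seed, `h_{w'}` disagrees with `h_{wstar}` with
probability at most `c₀` in the band. -/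
def Oracle.Succeeds {d : ℕ} (O : Oracle d) (D : Measure (Example d)) (wstar : UnitVec d)
    (tol c₀ γ α δ : ℝ) : Prop :=
  ∀ w : UnitVec d, theta w wstar ≤ α → err (bandDist D w γ) wstar ≤ tol →
    (∀ᵐ q ∂((Measure.pi fun _ : Fin (O.numSamples γ α δ) => D).prod
        (volume : Measure unitInterval)), theta (O.run w γ α δ q.1 q.2) w ≤ α) ∧
    1 - δ ≤ ((Measure.pi fun _ : Fin (O.numSamples γ α δ) => D).prod
        (volume : Measure unitInterval)).real
      {q | disagreement (bandDist D w γ) (O.run w γ α δ q.1 q.2) wstar ≤ c₀}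

/-- Localization with an oracle, run on a stream `S` of examples and a stream `ω` of seeds, with
confidence parameter `δ'` in each oracle call. The value at `k` is the pair of the vector
`w_{k+1}` (so `w₁` is the input vector) and the number of examples read in iterations `1, …, k`;
iteration `k + 1` calls the oracle on `(w_{k+1}, γ_{k+1}, α_{k+1}, δ')` and passes to it the
next unread examples. -/
def localize {d : ℕ} (C : Constants) (O : Oracle d) (w₁ : UnitVec d) (δ' : ℝ)
    (S : ℕ → Example d) (ω : ℕ → unitInterval) : ℕ → UnitVec d × ℕ
  | 0 => (w₁, 0)
  | k + 1 =>
    let s := localize C O w₁ δ' S ω k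
    (O.run s.1 (C.γ (k + 1)) (αk (k + 1)) δ' (fun i => S (s.2 + i)) (ω k),
      s.2 + O.numSamples (C.γ (k + 1)) (αk (k + 1)) δ')

/-- The whole algorithm: `r` iterations with confidence parameter `δ / r`; it returns the last
vector `w_{r+1}` together with the total number of examples read. -/
def localization {d : ℕ} (C : Constants) (O : Oracle d) (w₁ : UnitVec d) (ε δ : ℝ)
    (S : ℕ → Example d) (ω : ℕ → unitInterval) : UnitVec d × ℕ :=
  localize C O w₁ (δ / C.iterations ε) S ω (C.iterations ε)

/-- The law of an i.i.d. stream of examples from `D` and an independent stream of independent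
uniform seeds. -/
def streams {d : ℕ} (D : Measure (Example d)) [IsProbabilityMeasure D] :
    Measure ((ℕ → Example d) × (ℕ → unitInterval)) :=
  (Measure.infinitePi fun _ : ℕ => D).prod
    (Measure.infinitePi fun _ : ℕ => (volume : Measure unitInterval))

end Localization

end

noncomputable section

namespace Localization

/-! The proof has two halves: absolute constants for isotropic log-concave laws, and the analysis of
the algorithm given such constants.

For the constants, everything happens in a marginal of dimension one or two. By Prékopa–Leindler
(`prekopaLeindler`), built from one-dimensional Brunn–Minkowski, marginals of log-concave densities
are log-concave, and isotropy passes to them. The same inequality makes the tail t ↦ P(u·x ≥ t)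
log-concave, so Chebyshev's inequality upgrades to exponential decay. This bounds fourth moments,
hence E|u·x| from below, hence, the mean being zero, the mass of halfspaces {u·x ≥ r} from below.
Separating a point near the mean from the superlevel set above its value then bounds the density
from below there (`exists_density_lower_bound`). Log-concavity at midpoints bounds the density from
above, with decay ‖z‖⁻⁴ (`exists_density_upper_bound`). Two halfspaces at angle θ disagree on a
planar double wedge of total opening 2θ, and polar coordinates turn the density bounds into bounds
linear in θ. In the wedge |w·x| ≤ θ‖z‖, so a point of disagreement far from the boundary of w in
units of θ has large norm, and such points are rare.

For the algorithm, conditioning on a band only involves x, so the noise rate in every band is still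
at most ν and the oracle guarantee applies. The main step is `Constants.Valid.theta_le_half`. The
disagreement of w' and w* inside the band is at most c₀ times the band mass, which is at most αC₁/4
(C₁ the lower angle constant). Outside the band it forces w to disagree with w' or with w*, at cost
αC₁/8 each. The total αC₁/2 converts back to an angle at most α/2. Each iteration reads fresh
examples and a fresh seed, so the failure probabilities add up (`one_sub_le_streams_theta`). After r
halvings, `HasBoundedNoise.err_le_err` (w* is optimal) and the upper angle constant turn the final
angle into excess error at most ε. -/

/-! ### Brunn–Minkowski on the line and the Prékopa–Leindler inequality -/

open Set in
/-- One-dimensional Brunn–Minkowski inequality. -/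
theorem volume_add_volume_le_of_add_mem {A B C : Set ℝ} (hA : MeasurableSet A)
    (hB : MeasurableSet B) (hA' : A.Nonempty) (hB' : B.Nonempty)
    (hC : ∀ x ∈ A, ∀ y ∈ B, x + y ∈ C) : volume A + volume B ≤ volume C := by
  have key : ∀ K L : Set ℝ, K ⊆ A → IsCompact K → L ⊆ B → IsCompact L → K.Nonempty → L.Nonempty →
      volume K + volume L ≤ volume C := by
    intro K L hKA hK hLB hL hKn hLn
    -- With x₀ = max K and y₀ = min L, the translates K + y₀ and x₀ + L lie in C and meet only at x₀
    -- + y₀.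
    obtain ⟨x₀, hx₀, hx₀'⟩ := hK.exists_isGreatest hKn
    obtain ⟨y₀, hy₀, hy₀'⟩ := hL.exists_isLeast hLn
    have h1 : volume ((fun x => x + y₀) '' K) = volume K := by
      rw [image_add_right, measure_preimage_add_right]
    have h2 : volume ((fun x => x₀ + x) '' L) = volume L := by
      rw [image_add_left, measure_preimage_add]
    rw [← h1, ← h2, ← measure_union₀]
    · refine measure_mono ?_
      rintro _ (⟨x, hx, rfl⟩ | ⟨y, hy, rfl⟩)
      · exact hC _ (hKA hx) _ (hLB hy₀)
      · exact hC _ (hKA hx₀) _ (hLB hy)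
    · exact (hL.image (by fun_prop)).measurableSet.nullMeasurableSet
    · refine measure_mono_null (t := {x₀ + y₀}) ?_ (by simp)
      rintro _ ⟨⟨x, hx, rfl⟩, ⟨y, hy, hxy⟩⟩
      have := hx₀' hx
      have := hy₀' hy
      simp only [mem_singleton_iff] at *
      linarith
  obtain ⟨a, ha⟩ := hA'
  obtain ⟨b, hb⟩ := hB'
  rw [hA.measure_eq_iSup_isCompact, hB.measure_eq_iSup_isCompact]
  simp_rw [iSup_and']
  refine ENNReal.biSup_add_biSup_le' ⟨∅, by simp⟩ ⟨∅, by simp⟩ ?_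
  rintro K ⟨hK, hK'⟩ L ⟨hL, hL'⟩
  -- The compact sets supplied by inner regularity may be empty, so a point of A and a point of B
  -- are adjoined.
  refine le_trans ?_ (key (insert a K) (insert b L) (insert_subset ha hK) (hK'.insert a)
    (insert_subset hb hL) (hL'.insert b) (insert_nonempty _ _) (insert_nonempty _ _))
  gcongr <;> exact subset_insert _ _

open Set in
theorem lintegral_eq_setLIntegral_Ioo_meas_lt {f : ℝ → ENNReal} (hf : Measurable f)
    (hf1 : ∀ x, f x ≤ 1) :
    ∫⁻ x, f x = ∫⁻ t in Ioo (0 : ℝ) 1, volume {x | ENNReal.ofReal t < f x} := by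
  have hfin : ∀ x, f x ≠ ⊤ := fun x => ne_top_of_le_ne_top ENNReal.one_ne_top (hf1 x)
  have h0 := lintegral_eq_lintegral_meas_lt volume (f := fun x => (f x).toReal)
    (Filter.Eventually.of_forall fun x => ENNReal.toReal_nonneg) (by fun_prop)
  simp only [ENNReal.ofReal_toReal (hfin _)] at h0
  rw [h0, ← Ioo_union_Ici_eq_Ioi (zero_lt_one' ℝ), lintegral_union measurableSet_Ici]
  · rw [setLIntegral_congr_fun (g := fun _ => 0) measurableSet_Ici]
    · simp only [lintegral_zero, add_zero]
      refine setLIntegral_congr_fun measurableSet_Ioo ?_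
      intro t ht
      simp only
      congr 1 with x
      exact (ENNReal.ofReal_lt_iff_lt_toReal ht.1.le (hfin x)).symm
    · intro t ht
      simp only
      convert measure_empty (μ := volume)
      ext x
      simp only [mem_ofPred_eq, mem_empty_iff_false, iff_false, not_lt]
      refine le_trans ?_ ht
      exact ENNReal.toReal_le_of_le_ofReal zero_le_one (by simpa using hf1 x)
  · rw [Set.disjoint_left]
    rintro x hx hx'
    exact not_le.2 hx.2 hx'

theorem rpow_mul_rpow_le_add (x y : ENNReal) {a b : ℝ} (ha : 0 < a) (hb : 0 < b)
    (hab : a + b = 1) : x ^ a * y ^ b ≤ ENNReal.ofReal a * x + ENNReal.ofReal b * y := by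
  by_cases hx : x = ⊤
  · subst hx
    rw [ENNReal.mul_top (by simpa using ha), top_add]
    exact le_top
  by_cases hy : y = ⊤
  · subst hy
    rw [ENNReal.mul_top (by simpa using hb), add_top]
    exact le_top
  lift x to NNReal using hx
  lift y to NNReal using hy
  lift a to NNReal using ha.le
  lift b to NNReal using hb.le
  rw [← ENNReal.coe_rpow_of_nonneg _ ha.le, ← ENNReal.coe_rpow_of_nonneg _ hb.le]
  simp only [ENNReal.ofReal_coe_nnreal]
  norm_cast
  exact NNReal.geom_mean_le_arith_mean2_weighted a b x y (by exact_mod_cast hab)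

theorem rpow_mul_rpow_lt {t x y : ENNReal} {a b : ℝ} (ha : 0 < a) (hb : 0 < b) (hab : a + b = 1)
    (hx : t < x) (hy : t < y) : t < x ^ a * y ^ b := by
  calc t = t ^ a * t ^ b := by
        rw [← ENNReal.rpow_add_of_nonneg _ _ ha.le hb.le, hab, ENNReal.rpow_one]
    _ < x ^ a * y ^ b :=
        ENNReal.mul_lt_mul (ENNReal.rpow_lt_rpow hx ha) (ENNReal.rpow_lt_rpow hy hb)

-- With both suprema equal to 1, for t < 1 the sets {f > t} and {g > t} are nonempty, and a{f > t} +
-- b{g > t} ⊆ {h > t}. Brunn–Minkowski at each level and the layer-cake formula give the inequality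
-- with a weighted arithmetic mean, which is stronger than the geometric one.
open Set Pointwise in
theorem prekopaLeindler_of_sup_eq_one {f g h : ℝ → ENNReal} (hf : Measurable f)
    (hg : Measurable g) (hh : Measurable h) {a b : ℝ} (ha : 0 < a) (hb : 0 < b) (hab : a + b = 1)
    (hf1 : ∀ x, f x ≤ 1) (hg1 : ∀ x, g x ≤ 1) (hf2 : ∀ t < 1, ∃ x, t < f x)
    (hg2 : ∀ t < 1, ∃ x, t < g x) (H : ∀ x y, f x ^ a * g y ^ b ≤ h (a * x + b * y)) :
    (∫⁻ x, f x) ^ a * (∫⁻ x, g x) ^ b ≤ ∫⁻ x, h x := by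
  refine (rpow_mul_rpow_le_add _ _ ha hb hab).trans ?_
  have hm : Measurable fun x => min (h x) 1 := hh.min measurable_const
  -- The layer-cake formula over (0, 1) needs a function bounded by 1, so h is truncated; the levels
  -- t < 1 are unaffected.
  refine le_trans ?_ (lintegral_mono (f := fun x => min (h x) 1) fun x => min_le_left _ _)
  rw [lintegral_eq_setLIntegral_Ioo_meas_lt hf hf1, lintegral_eq_setLIntegral_Ioo_meas_lt hg hg1,
    lintegral_eq_setLIntegral_Ioo_meas_lt hm fun x => min_le_right _ _,
    ← lintegral_const_mul' _ _ ENNReal.ofReal_ne_top,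
    ← lintegral_const_mul' _ _ ENNReal.ofReal_ne_top, ← lintegral_add_left]
  · refine setLIntegral_mono' measurableSet_Ioo fun t ht => ?_
    have ht1 : ENNReal.ofReal t < 1 := by
      rw [← ENNReal.ofReal_one]
      exact (ENNReal.ofReal_lt_ofReal_iff one_pos).2 ht.2
    have e1 : ∀ s : Set ℝ, ∀ c : ℝ, 0 < c → ENNReal.ofReal c * volume s = volume (c • s) := by
      intro s c hc
      rw [Measure.addHaar_smul]
      simp [abs_of_pos hc]
    rw [e1 _ a ha, e1 _ b hb]
    obtain ⟨x₀, hx₀⟩ := hf2 _ ht1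
    obtain ⟨y₀, hy₀⟩ := hg2 _ ht1
    refine volume_add_volume_le_of_add_mem
      ((measurableSet_lt measurable_const hf).const_smul₀ a)
      ((measurableSet_lt measurable_const hg).const_smul₀ b)
      ⟨_, x₀, hx₀, rfl⟩ ⟨_, y₀, hy₀, rfl⟩ ?_
    rintro _ ⟨x, hx, rfl⟩ _ ⟨y, hy, rfl⟩
    exact lt_min ((rpow_mul_rpow_lt ha hb hab hx hy).trans_le (H x y)) ht1
  · refine Measurable.const_mul ?_ _
    exact Antitone.measurable fun s t hst => measure_mono fun x hx =>
      (ENNReal.ofReal_le_ofReal hst).trans_lt hx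

/-- By homogeneity: dividing f and g by their suprema A and B, and h by A^a B^b, preserves the
hypothesis. Boundedness keeps A and B finite, and a zero supremum makes the left side vanish. -/
theorem prekopaLeindler_of_bounded {f g h : ℝ → ENNReal} (hf : Measurable f)
    (hg : Measurable g) (hh : Measurable h) {a b : ℝ} (ha : 0 < a) (hb : 0 < b) (hab : a + b = 1)
    {c : ENNReal} (hc : c ≠ ⊤) (hf1 : ∀ x, f x ≤ c) (hg1 : ∀ x, g x ≤ c)
    (H : ∀ x y, f x ^ a * g y ^ b ≤ h (a * x + b * y)) :
    (∫⁻ x, f x) ^ a * (∫⁻ x, g x) ^ b ≤ ∫⁻ x, h x := by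
  set A := ⨆ x, f x with hA
  set B := ⨆ x, g x with hB
  have hAt : A ≠ ⊤ := ne_top_of_le_ne_top hc (iSup_le hf1)
  have hBt : B ≠ ⊤ := ne_top_of_le_ne_top hc (iSup_le hg1)
  by_cases hA0 : A = 0
  · have : ∀ x, f x = 0 := fun x => le_antisymm (hA0 ▸ le_iSup f x) bot_le
    simp [this, ENNReal.zero_rpow_of_pos ha]
  by_cases hB0 : B = 0
  · have : ∀ x, g x = 0 := fun x => le_antisymm (hB0 ▸ le_iSup g x) bot_le
    simp [this, ENNReal.zero_rpow_of_pos hb]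
  have hsup : ∀ (u : ℝ → ENNReal) (U : ENNReal), U = ⨆ x, u x → U ≠ 0 → U ≠ ⊤ →
      (∀ x, U⁻¹ * u x ≤ 1) ∧ ∀ t < 1, ∃ x, t < U⁻¹ * u x := by
    intro u U hU h0 hT
    constructor
    · intro x
      rw [mul_comm, ← div_eq_mul_inv]
      exact ENNReal.div_le_of_le_mul (by simpa using hU ▸ le_iSup u x)
    · intro t ht
      have : t < ⨆ x, U⁻¹ * u x := by
        rwa [← ENNReal.mul_iSup, ← hU, ENNReal.inv_mul_cancel h0 hT]
      exact lt_iSup_iff.1 this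
  obtain ⟨f1, f2⟩ := hsup f A hA hA0 hAt
  obtain ⟨g1, g2⟩ := hsup g B hB hB0 hBt
  have hpA : A ^ a ≠ 0 := by simp [hA0, hAt, ENNReal.rpow_eq_zero_iff]
  have hpB : B ^ b ≠ 0 := by simp [hB0, hBt, ENNReal.rpow_eq_zero_iff]
  have hpA' : A ^ a ≠ ⊤ := ENNReal.rpow_ne_top_of_nonneg ha.le hAt
  have hpB' : B ^ b ≠ ⊤ := ENNReal.rpow_ne_top_of_nonneg hb.le hBt
  have hmul : ∀ x y, (A⁻¹ * x) ^ a * (B⁻¹ * y) ^ b = (A ^ a * B ^ b)⁻¹ * (x ^ a * y ^ b) := by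
    intro x y
    rw [ENNReal.mul_rpow_of_nonneg _ _ ha.le, ENNReal.mul_rpow_of_nonneg _ _ hb.le,
      ENNReal.inv_rpow, ENNReal.inv_rpow, ENNReal.mul_inv (Or.inl hpA) (Or.inl hpA')]
    ring
  have key := prekopaLeindler_of_sup_eq_one (hf.const_mul A⁻¹) (hg.const_mul B⁻¹)
    (hh.const_mul (A ^ a * B ^ b)⁻¹) ha hb hab f1 g1 f2 g2 (fun x y => by
      rw [hmul]; gcongr; exact H x y)
  rw [lintegral_const_mul _ hf, lintegral_const_mul _ hg, lintegral_const_mul _ hh, hmul] at key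
  refine (ENNReal.mul_le_mul_iff_right ?_ ?_).1 key
  · exact ENNReal.inv_ne_zero.2 (ENNReal.mul_ne_top hpA' hpB')
  · exact ENNReal.inv_ne_top.2 (mul_ne_zero hpA hpB)

/-- One-dimensional Prékopa–Leindler inequality. -/
theorem prekopaLeindler_real {f g h : ℝ → ENNReal} (hf : Measurable f)
    (hg : Measurable g) (hh : Measurable h) {a b : ℝ} (ha : 0 < a) (hb : 0 < b) (hab : a + b = 1)
    (H : ∀ x y, f x ^ a * g y ^ b ≤ h (a * x + b * y)) :
    (∫⁻ x, f x) ^ a * (∫⁻ x, g x) ^ b ≤ ∫⁻ x, h x := by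
  have hmono : ∀ u : ℝ → ENNReal, Monotone fun (n : ℕ) x => min (u x) (n : ENNReal) := by
    intro u m n hmn x
    exact min_le_min le_rfl (by exact_mod_cast hmn)
  have hsup : ∀ u : ℝ → ENNReal, Measurable u →
      ∫⁻ x, u x = ⨆ n : ℕ, ∫⁻ x, min (u x) (n : ENNReal) := by
    intro u hu
    rw [← lintegral_iSup (fun n => hu.min measurable_const) (hmono u)]
    congr 1 with x
    rw [← inf_iSup_eq, ENNReal.iSup_natCast, inf_top_eq]
  have hpow : ∀ (u : ℕ → ENNReal) (c : ℝ), 0 < c → (⨆ n, u n) ^ c = ⨆ n, u n ^ c := fun u c hc =>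
    (ENNReal.orderIsoRpow c hc).map_iSup u
  -- Only f and g are truncated at integer levels; monotone convergence recovers their integrals.
  rw [hsup f hf, hsup g hg, hpow _ a ha, hpow _ b hb, ENNReal.iSup_mul]
  refine iSup_le fun m => ?_
  rw [ENNReal.mul_iSup]
  refine iSup_le fun n => ?_
  refine prekopaLeindler_of_bounded (c := max m n) (hf.min measurable_const)
    (hg.min measurable_const) hh ha hb hab (by simp)
    (fun x => (min_le_right _ _).trans (le_max_left _ _))
    (fun x => (min_le_right _ _).trans (le_max_right _ _)) fun x y => ?_
  refine le_trans ?_ (H x y)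
  gcongr <;> exact min_le_left _ _

/-- Prékopa–Leindler inequality in `Fin n → ℝ`. -/
theorem prekopaLeindler_pi {a b : ℝ} (ha : 0 < a) (hb : 0 < b) (hab : a + b = 1) :
    ∀ (n : ℕ) {f g h : (Fin n → ℝ) → ENNReal}, Measurable f → Measurable g → Measurable h →
      (∀ x y, f x ^ a * g y ^ b ≤ h (a • x + b • y)) →
      (∫⁻ x, f x) ^ a * (∫⁻ x, g x) ^ b ≤ ∫⁻ x, h x
  | 0, f, g, h, _, _, _, H => by
    simpa [Measure.volume_pi_eq_dirac (0 : Fin 0 → ℝ)] using H 0 0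
  | n + 1, f, g, h, hf, hg, hh, H => by
    let e := (MeasurableEquiv.piFinSuccAbove (fun _ : Fin (n + 1) => ℝ) 0).symm
    have he : MeasurePreserving e volume volume :=
      (volume_preserving_piFinSuccAbove (fun _ : Fin (n + 1) => ℝ) 0).symm
    have hadd : ∀ s t : ℝ, ∀ x y : Fin n → ℝ,
        a • e (s, x) + b • e (t, y) = e (a * s + b * t, a • x + b • y) := by
      intro s t x y
      ext i
      refine Fin.cases ?_ (fun j => ?_) i <;> simp [e, MeasurableEquiv.piFinSuccAbove]
    have hint : ∀ u : (Fin (n + 1) → ℝ) → ENNReal, Measurable u →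
        ∫⁻ x, u x = ∫⁻ s : ℝ, ∫⁻ x : Fin n → ℝ, u (e (s, x)) := by
      intro u hu
      rw [← he.lintegral_comp hu]
      exact lintegral_prod _ (hu.comp e.measurable).aemeasurable
    have hmeas : ∀ u : (Fin (n + 1) → ℝ) → ENNReal, Measurable u →
        Measurable fun s : ℝ => ∫⁻ x : Fin n → ℝ, u (e (s, x)) := fun u hu =>
      (hu.comp e.measurable).lintegral_prod_right'
    rw [hint f hf, hint g hg, hint h hh]
    -- The one-dimensional inequality is applied to the integrals over slices; its hypothesis is the
    -- inductive statement for the slices at s, t and a s + b t.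
    refine prekopaLeindler_real (hmeas f hf) (hmeas g hg) (hmeas h hh) ha hb hab fun s t => ?_
    refine prekopaLeindler_pi ha hb hab n (f := fun x => f (e (s, x))) (g := fun x => g (e (t, x)))
      (h := fun x => h (e (a * s + b * t, x)))
      (hf.comp (e.measurable.comp measurable_prodMk_left))
      (hg.comp (e.measurable.comp measurable_prodMk_left))
      (hh.comp (e.measurable.comp measurable_prodMk_left)) fun x y => ?_
    rw [← hadd]
    exact H _ _

/-- Prékopa–Leindler inequality in Euclidean space. -/
theorem prekopaLeindler {n : ℕ} {f g h : EuclideanSpace ℝ (Fin n) → ENNReal} (hf : Measurable f)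
    (hg : Measurable g) (hh : Measurable h) {a b : ℝ} (ha : 0 < a) (hb : 0 < b) (hab : a + b = 1)
    (H : ∀ x y, f x ^ a * g y ^ b ≤ h (a • x + b • y)) :
    (∫⁻ x, f x) ^ a * (∫⁻ x, g x) ^ b ≤ ∫⁻ x, h x := by
  have hmp := PiLp.volume_preserving_toLp (Fin n)
  rw [← hmp.lintegral_comp hf, ← hmp.lintegral_comp hg, ← hmp.lintegral_comp hh]
  refine prekopaLeindler_pi ha hb hab n (hf.comp hmp.measurable) (hg.comp hmp.measurable)
    (hh.comp hmp.measurable) fun x y => ?_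
  simpa using H (WithLp.toLp 2 x) (WithLp.toLp 2 y)

/-! ### Log-concave densities, isotropy and marginals -/

/-- Logarithmic concavity of an extended nonnegative function, in multiplicative form. -/
def LogConcave {E : Type*} [AddCommGroup E] [Module ℝ E] (q : E → ENNReal) : Prop :=
  ∀ (x y : E) (a b : ℝ), 0 < a → 0 < b → a + b = 1 → q x ^ a * q y ^ b ≤ q (a • x + b • y)

/-- `P` is an isotropic probability distribution with the log-concave density `q`. -/
structure HasIsotropicDensity {n : ℕ} (P : Measure (Inst n)) (q : Inst n → ENNReal) : Prop where
  isProbabilityMeasure : IsProbabilityMeasure P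
  measurable : Measurable q
  logConcave : LogConcave q
  eq_withDensity : P = volume.withDensity q
  memLp : MemLp (fun x : Inst n => x) 2 P
  integral_inner : ∀ u : Inst n, ∫ x, inner ℝ u x ∂P = 0
  integral_inner_mul_inner : ∀ u v : Inst n, ∫ x, inner ℝ u x * inner ℝ v x ∂P = inner ℝ u v

theorem memLp_coord {n : ℕ} {P : Measure (Inst n)} (h : MemLp (fun x : Inst n => x) 2 P)
    (i : Fin n) : MemLp (fun x : Inst n => x i) 2 P :=
  h.continuousLinearMap_comp (EuclideanSpace.proj i : Inst n →L[ℝ] ℝ)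

theorem IsIsotropicLogConcave.exists_hasIsotropicDensity {n : ℕ} {P : Measure (Inst n)}
    (hP : IsIsotropicLogConcave P) : ∃ q, HasIsotropicDensity P q := by
  obtain ⟨hprob, ⟨p, hpm, hp0, hPp, hconc⟩, hL2, hmean, hcov⟩ := hP
  have hL := memLp_coord hL2
  refine ⟨fun x => ENNReal.ofReal (p x), hprob, hpm.ennreal_ofReal, ?_, hPp, hL2, ?_, ?_⟩
  · intro x y a b ha hb hab
    rcases (hp0 x).eq_or_lt with hx | hx
    · simp [← hx, ENNReal.zero_rpow_of_pos ha]
    rcases (hp0 y).eq_or_lt with hy | hy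
    · simp [← hy, ENNReal.zero_rpow_of_pos hb]
    have h1 : 0 < p (a • x + b • y) := hconc.1 hx hy ha.le hb.le hab
    have h2 := hconc.2 hx hy ha.le hb.le hab
    rw [ENNReal.ofReal_rpow_of_nonneg hx.le ha.le, ENNReal.ofReal_rpow_of_nonneg hy.le hb.le,
      ← ENNReal.ofReal_mul (by positivity)]
    refine ENNReal.ofReal_le_ofReal ?_
    rw [← Real.log_le_log_iff (by positivity) h1, Real.log_mul (by positivity) (by positivity),
      Real.log_rpow hx, Real.log_rpow hy]
    simpa using h2
  · intro u
    simp only [PiLp.inner_apply, RCLike.inner_apply, conj_trivial]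
    rw [integral_finsetSum _ fun i _ => ((hL i).integrable one_le_two).mul_const _]
    simp [integral_mul_const, hmean]
  · intro u v
    have hi : ∀ i j, Integrable (fun x : Inst n => (x i * u i) * (x j * v j)) P := fun i j => by
      refine (((hL i).integrable_mul (hL j)).mul_const (u i * v j)).congr ?_
      refine Filter.Eventually.of_forall fun x => ?_
      simp only [Pi.mul_apply]
      ring
    simp only [PiLp.inner_apply, RCLike.inner_apply, conj_trivial, Finset.sum_mul_sum]
    rw [integral_finsetSum _ fun i _ => integrable_finsetSum _ fun j _ => hi i j]
    have : ∀ i j, ∫ x : Inst n, (x i * u i) * (x j * v j) ∂P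
        = (if i = j then 1 else 0) * (u i * v j) := by
      intro i j
      rw [← hcov i j, ← integral_mul_const]
      congr 1 with x
      ring
    simp_rw [integral_finsetSum _ fun j _ => hi _ j, this]
    simp [mul_comm]

/-- The coordinates of a vector along a family of vectors. -/
def coords {n d : ℕ} (v : Fin n → Inst d) (x : Inst d) : Inst n :=
  WithLp.toLp 2 fun i => inner ℝ (v i) x

theorem continuous_coords {n d : ℕ} (v : Fin n → Inst d) : Continuous (coords v) := by
  unfold coords
  fun_prop

theorem inner_coords {n d : ℕ} (v : Fin n → Inst d) (u : Inst n) (x : Inst d) :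
    inner ℝ u (coords v x) = inner ℝ (∑ i, u i • v i) x := by
  simp [coords, PiLp.inner_apply, sum_inner, inner_smul_left, mul_comm]

theorem norm_coords_le {n d : ℕ} {v : Fin n → Inst d} (hv : Orthonormal ℝ v) (x : Inst d) :
    ‖coords v x‖ ≤ ‖x‖ := by
  refine le_of_sq_le_sq ?_ (norm_nonneg _)
  rw [EuclideanSpace.norm_sq_eq]
  exact hv.sum_inner_products_le x

/-- The density of a marginal of a log-concave distribution is log-concave. -/
theorem exists_marginal_density {n d : ℕ} {v : Fin n → Inst d} (hv : Orthonormal ℝ v)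
    {q : Inst d → ENNReal} (hq : Measurable q) (hqc : LogConcave q) :
    ∃ q' : Inst n → ENNReal, Measurable q' ∧ LogConcave q' ∧
      (volume.withDensity q).map (coords v) = volume.withDensity q' := by
  obtain ⟨m, rfl⟩ : ∃ m, d = n + m := Nat.exists_eq_add_of_le (by
    simpa using hv.linearIndependent.fintype_card_le_finrank)
  obtain ⟨b, hb⟩ := Orthonormal.exists_orthonormalBasis_extension_of_card_eq (𝕜 := ℝ)
    (ι := Fin n ⊕ Fin m) (E := Inst (n + m)) (by simp) (v := Sum.elim v 0)
    (s := Set.range Sum.inl) (by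
      let e : Set.range (Sum.inl : Fin n → Fin n ⊕ Fin m) ≃ Fin n :=
        (Equiv.ofInjective _ Sum.inl_injective).symm
      have he : (Set.range Sum.inl).domRestrict (Sum.elim v (0 : Fin m → _)) = v ∘ e := by
        ext1 ⟨_, i, rfl⟩
        simp [e, Set.domRestrict]
      rw [he]
      exact hv.comp e e.injective)
  let Ψ : Inst n × (Fin m → ℝ) → Inst (n + m) := fun p =>
    b.repr.symm (WithLp.toLp 2 (Sum.elim p.1.ofLp p.2))
  have hΨ : MeasurePreserving Ψ volume volume := by
    have h1 : MeasurePreserving (Prod.map (@WithLp.ofLp 2 (Fin n → ℝ)) (id : (Fin m → ℝ) → _))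
        volume volume := (PiLp.volume_preserving_ofLp (Fin n)).prod (MeasurePreserving.id _)
    have h2 := (volume_measurePreserving_sumPiEquivProdPi (fun _ : Fin n ⊕ Fin m => ℝ)).symm
    have h3 := PiLp.volume_preserving_toLp (Fin n ⊕ Fin m)
    have h4 := LinearIsometryEquiv.measurePreserving b.repr.symm
    have hcomp : Ψ = b.repr.symm ∘ WithLp.toLp 2 ∘
        (MeasurableEquiv.sumPiEquivProdPi fun _ : Fin n ⊕ Fin m => ℝ).symm ∘
        Prod.map WithLp.ofLp id := by
      ext1 p
      simp only [Ψ, Function.comp]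
      congr 2
    rw [hcomp]
    exact h4.comp (h3.comp (h2.comp h1))
  have hΨadd : ∀ (s t : ℝ) z z' y y', s • Ψ (z, y) + t • Ψ (z', y')
      = Ψ (s • z + t • z', s • y + t • y') := by
    intro s t z z' y y'
    simp only [Ψ, ← map_smul, ← map_add]
    congr 1
    ext i
    cases i <;> simp
  have hΨv : ∀ z y, coords v (Ψ (z, y)) = z := by
    intro z y
    ext i
    have : v i = b (Sum.inl i) := by rw [hb _ ⟨i, rfl⟩]; rfl
    simp only [coords, this, Ψ]
    rw [← b.repr_apply_apply]
    simp
  have hqΨ : Measurable fun p => q (Ψ p) := hq.comp hΨ.measurable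
  refine ⟨fun z => ∫⁻ y, q (Ψ (z, y)), hqΨ.lintegral_prod_right', ?_, ?_⟩
  · intro z z' s t hs ht hst
    refine prekopaLeindler_pi hs ht hst m (hqΨ.comp measurable_prodMk_left)
      (hqΨ.comp measurable_prodMk_left) (hqΨ.comp measurable_prodMk_left) fun y y' => ?_
    rw [← hΨadd]
    exact hqc _ _ _ _ hs ht hst
  · ext A hA
    have hcm := (continuous_coords v).measurable
    rw [Measure.map_apply hcm hA, withDensity_apply _ (hcm hA), withDensity_apply _ hA,
      ← lintegral_indicator (hcm hA), ← lintegral_indicator hA,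
      ← hΨ.lintegral_comp (hq.indicator (hcm hA))]
    refine (lintegral_prod (fun p => (coords v ⁻¹' A).indicator q (Ψ p))
      ((hq.indicator (hcm hA)).comp hΨ.measurable).aemeasurable).trans ?_
    refine lintegral_congr fun z => ?_
    by_cases hz : z ∈ A <;> simp [Set.indicator, hΨv, hz]

/-- `coords v` is the adjoint of the isometric embedding u ↦ ∑ uᵢ vᵢ, so linear functionals pull
back to linear functionals and inner products are preserved. This reduces later estimates to
dimensions one and two. -/
theorem HasIsotropicDensity.map_coords {n d : ℕ} {v : Fin n → Inst d} (hv : Orthonormal ℝ v)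
    {P : Measure (Inst d)} {q : Inst d → ENNReal} (h : HasIsotropicDensity P q) :
    ∃ q', HasIsotropicDensity (P.map (coords v)) q' := by
  obtain ⟨q', hm, hc, he⟩ := exists_marginal_density hv h.measurable h.logConcave
  have := h.isProbabilityMeasure
  have hcv := (continuous_coords v).measurable
  refine ⟨q', Measure.isProbabilityMeasure_map hcv.aemeasurable, hm, hc, ?_, ?_, ?_, ?_⟩
  · rw [← he, ← h.eq_withDensity]
  · rw [memLp_map_measure_iff (by fun_prop) hcv.aemeasurable]
    exact h.memLp.mono (by fun_prop) (Filter.Eventually.of_forall fun x => norm_coords_le hv x)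
  · intro u
    rw [integral_map hcv.aemeasurable (by fun_prop)]
    simp_rw [inner_coords, h.integral_inner]
  · intro u w
    rw [integral_map hcv.aemeasurable (by fun_prop)]
    simp_rw [inner_coords, h.integral_inner_mul_inner]
    simp [hv.inner_sum, PiLp.inner_apply, mul_comm]

/-! ### Tails and moments of one-dimensional marginals -/

namespace HasIsotropicDensity

variable {n : ℕ} {P : Measure (Inst n)} {q : Inst n → ENNReal}

theorem memLp_inner (h : HasIsotropicDensity P q) (u : Inst n) :
    MemLp (fun x => (inner ℝ u x : ℝ)) 2 P :=
  h.memLp.continuousLinearMap_comp (innerSL ℝ u)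

theorem integral_inner_sq (h : HasIsotropicDensity P q) {u : Inst n} (hu : ‖u‖ = 1) :
    ∫ x, (inner ℝ u x : ℝ) ^ 2 ∂P = 1 := by
  simp_rw [sq, h.integral_inner_mul_inner, real_inner_self_eq_norm_sq, hu]
  norm_num

theorem measure_le_inner_sq_le (h : HasIsotropicDensity P q) {u : Inst n} (hu : ‖u‖ = 1) :
    P.real {x | 4 ≤ (inner ℝ u x : ℝ) ^ 2} ≤ 1 / 4 := by
  have := h.isProbabilityMeasure
  have := mul_meas_ge_le_integral_of_nonneg (μ := P) (f := fun x => (inner ℝ u x : ℝ) ^ 2)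
    (Filter.Eventually.of_forall fun x => sq_nonneg _) (h.memLp_inner u).integrable_sq 4
  rw [h.integral_inner_sq hu] at this
  linarith

/-- The mass of halfspaces orthogonal to a given vector is log-concave. -/
theorem measure_halfspace_mul_le (h : HasIsotropicDensity P q) (u : Inst n) (s t : ℝ) {a b : ℝ}
    (ha : 0 < a) (hb : 0 < b) (hab : a + b = 1) :
    P {x | s ≤ inner ℝ u x} ^ a * P {x | t ≤ inner ℝ u x} ^ b
      ≤ P {x | a * s + b * t ≤ inner ℝ u x} := by
  have hm : ∀ t : ℝ, MeasurableSet {x : Inst n | t ≤ inner ℝ u x} := fun t =>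
    measurableSet_le measurable_const (by fun_prop)
  simp_rw [h.eq_withDensity, withDensity_apply _ (hm _), ← lintegral_indicator (hm _)]
  refine prekopaLeindler (h.measurable.indicator (hm _)) (h.measurable.indicator (hm _))
    (h.measurable.indicator (hm _)) ha hb hab fun x y => ?_
  by_cases hx : s ≤ inner ℝ u x
  · by_cases hy : t ≤ inner ℝ u y
    · have hxy : a * s + b * t ≤ inner ℝ u (a • x + b • y) := by
        rw [inner_add_right, inner_smul_right, inner_smul_right]
        gcongr
      simpa [Set.indicator, hx, hy, hxy] using h.logConcave x y a b ha hb hab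
    · simp [Set.indicator, hy, ENNReal.zero_rpow_of_pos hb]
  · simp [Set.indicator, hx, ENNReal.zero_rpow_of_pos ha]

/-- Chebyshev's inequality puts mass at least 3/4 above -2 and at most 1/4 above 2. A log-concave
tail that drops by a factor 3 over this interval must keep dropping geometrically. -/
theorem measure_real_le_inner_le (h : HasIsotropicDensity P q) {u : Inst n} (hu : ‖u‖ = 1)
    (t : ℝ) :
    P.real {x | t ≤ inner ℝ u x} ≤ 3 * (1 / 3) ^ (t / 4) := by
  have := h.isProbabilityMeasure
  have e : (3 : ℝ) * (1 / 3) ^ (t / 4) = (1 / 3) ^ ((t - 4) / 4) := by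
    rw [sub_div, Real.rpow_sub (by norm_num)]
    norm_num
    ring
  rw [e]
  rcases le_or_gt t 4 with ht4 | ht4
  · refine measureReal_le_one.trans ?_
    exact Real.one_le_rpow_of_pos_of_le_one_of_nonpos (by norm_num) (by norm_num) (by linarith)
  have h4 := h.measure_le_inner_sq_le hu
  have h2 : P.real {x | 2 ≤ inner ℝ u x} ≤ 1 / 4 := by
    refine (measureReal_mono fun x hx => ?_).trans h4
    simp only [Set.mem_ofPred_eq] at *
    nlinarith
  have h2' : 3 / 4 ≤ P.real {x | -2 ≤ inner ℝ u x} := by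
    have h5 : P.real {x : Inst n | -2 ≤ inner ℝ u x}ᶜ ≤ 1 / 4 := by
      refine (measureReal_mono fun x hx => ?_).trans h4
      simp only [Set.mem_ofPred_eq, Set.mem_compl_iff, not_le] at *
      nlinarith
    rw [probReal_compl_eq_one_sub (measurableSet_le measurable_const (by fun_prop))] at h5
    linarith
  -- This weight makes 2 the convex combination of -2 and t. Then (3/4) F^b ≤ 1/4, so F is at most
  -- (1/3)^((t + 2)/4).
  set b : ℝ := 4 / (t + 2) with hb
  have hb0 : 0 < b := by positivity
  have hb1 : b < 1 := by rw [hb, div_lt_one (by linarith)]; linarith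
  have key := h.measure_halfspace_mul_le u (-2) t (a := 1 - b) (b := b) (by linarith) hb0 (by ring)
  have e2 : (1 - b) * -2 + b * t = 2 := by
    rw [hb]; field_simp; ring
  rw [e2] at key
  have key' := ENNReal.toReal_mono (measure_ne_top _ _) key
  rw [ENNReal.toReal_mul, ← ENNReal.toReal_rpow, ← ENNReal.toReal_rpow] at key'
  change P.real _ ^ (1 - b) * P.real _ ^ b ≤ P.real _ at key'
  set F := P.real {x | t ≤ inner ℝ u x} with hF
  have hF0 : 0 ≤ F := measureReal_nonneg
  have h6 : (3 / 4 : ℝ) ≤ P.real {x | -2 ≤ inner ℝ u x} ^ (1 - b) := by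
    calc (3 / 4 : ℝ) = (3 / 4) ^ (1 : ℝ) := by simp
      _ ≤ (3 / 4) ^ (1 - b) :=
        Real.rpow_le_rpow_of_exponent_ge (by norm_num) (by norm_num) (by linarith)
      _ ≤ _ := Real.rpow_le_rpow (by norm_num) h2' (by linarith)
  have h7 : F ^ b ≤ 1 / 3 := by
    have : 3 / 4 * F ^ b ≤ 1 / 4 :=
      (mul_le_mul_of_nonneg_right h6 (by positivity)).trans (key'.trans h2)
    linarith
  calc F = (F ^ b) ^ b⁻¹ := by rw [← Real.rpow_mul hF0, mul_inv_cancel₀ hb0.ne', Real.rpow_one]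
    _ ≤ (1 / 3) ^ b⁻¹ := Real.rpow_le_rpow (by positivity) h7 (by positivity)
    _ ≤ (1 / 3) ^ ((t - 4) / 4) := by
      refine Real.rpow_le_rpow_of_exponent_ge (by norm_num) (by norm_num) ?_
      rw [hb, inv_div]
      linarith

theorem measure_real_le_abs_inner_le (h : HasIsotropicDensity P q) {u : Inst n} (hu : ‖u‖ = 1)
    (k : ℕ) :
    P.real {x | (k : ℝ) ≤ |inner ℝ u x|} ≤ 6 * ((1 / 3 : ℝ) ^ (1 / 4 : ℝ)) ^ k := by
  have := h.isProbabilityMeasure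
  have h1 := h.measure_real_le_inner_le hu k
  have h2 := h.measure_real_le_inner_le (u := -u) (by simpa using hu) k
  have e : ((1 / 3 : ℝ) ^ (1 / 4 : ℝ)) ^ k = (1 / 3) ^ ((k : ℝ) / 4) := by
    rw [← Real.rpow_natCast, ← Real.rpow_mul (by norm_num)]
    ring_nf
  rw [e]
  have h3 : {x : Inst n | (k : ℝ) ≤ |inner ℝ u x|}
      ⊆ {x | (k : ℝ) ≤ inner ℝ u x} ∪ {x | (k : ℝ) ≤ inner ℝ (-u) x} := by
    intro x hx
    simpa [le_abs] using hx
  have h4 := (measureReal_mono (μ := P) h3).trans (measureReal_union_le _ _)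
  linarith

end HasIsotropicDensity

/-- The one-dimensional marginals of isotropic log-concave distributions have uniformly bounded
fourth moments. -/
theorem exists_fourth_moment_bound : ∃ K : ℝ, 0 < K ∧ ∀ (n : ℕ) (P : Measure (Inst n))
    (q : Inst n → ENNReal), HasIsotropicDensity P q → ∀ u : Inst n, ‖u‖ = 1 →
      ∫⁻ x, ENNReal.ofReal ((inner ℝ u x : ℝ) ^ 4) ∂P ≤ ENNReal.ofReal K := by
  set ρ : ℝ := (1 / 3 : ℝ) ^ (1 / 4 : ℝ) with hρ
  have hρ0 : 0 < ρ := by positivity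
  have hρ1 : ρ < 1 := Real.rpow_lt_one (by norm_num) (by norm_num) (by norm_num)
  set c : ℕ → ℝ := fun k => ((k : ℝ) + 1) ^ 4 * (6 * ρ ^ k) with hc
  have hc0 : ∀ k, 0 < c k := fun k => by positivity
  have hs : Summable c := by
    have := (summable_nat_add_iff 1).2
      (summable_pow_mul_geometric_of_norm_lt_one 4 (r := ρ) (by
        rwa [Real.norm_of_nonneg hρ0.le]))
    refine (this.mul_left (6 / ρ)).congr fun k => ?_
    simp only [hc]
    push_cast
    field_simp
    ring
  refine ⟨∑' k, c k, hs.tsum_pos (fun k => (hc0 k).le) 0 (hc0 0), ?_⟩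
  intro n P q h u hu
  have := h.isProbabilityMeasure
  have hm : ∀ k : ℕ, MeasurableSet {x : Inst n | (k : ℝ) ≤ |inner ℝ u x|} := fun k =>
    measurableSet_le measurable_const (by fun_prop)
  calc ∫⁻ x, ENNReal.ofReal ((inner ℝ u x : ℝ) ^ 4) ∂P
      ≤ ∫⁻ x, ∑' k : ℕ, {x : Inst n | (k : ℝ) ≤ |inner ℝ u x|}.indicator
          (fun _ => ENNReal.ofReal (((k : ℝ) + 1) ^ 4)) x ∂P := by
        refine lintegral_mono fun x => ?_
        -- The single term of the series at the integer part of |u·x| already dominates.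
        set k := ⌊|inner ℝ u x|⌋₊ with hk
        have hk1 : (k : ℝ) ≤ |inner ℝ u x| := Nat.floor_le (abs_nonneg _)
        have hk2 : |inner ℝ u x| ≤ (k : ℝ) + 1 := (Nat.lt_floor_add_one _).le
        refine le_trans ?_ (ENNReal.le_tsum k)
        rw [Set.indicator_of_mem (by exact hk1)]
        refine ENNReal.ofReal_le_ofReal ?_
        rw [← (show Even 4 by decide).pow_abs]
        gcongr
    _ = ∑' k : ℕ, ENNReal.ofReal (((k : ℝ) + 1) ^ 4)
          * P {x : Inst n | (k : ℝ) ≤ |inner ℝ u x|} := by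
        rw [lintegral_tsum fun k => (measurable_const.indicator (hm k)).aemeasurable]
        simp_rw [lintegral_indicator_const (hm _)]
    _ ≤ ∑' k : ℕ, ENNReal.ofReal (c k) := by
        refine ENNReal.tsum_le_tsum fun k => ?_
        rw [hc, ENNReal.ofReal_mul (by positivity)]
        gcongr
        rw [← ofReal_measureReal]
        exact ENNReal.ofReal_le_ofReal (h.measure_real_le_abs_inner_le hu k)
    _ = ENNReal.ofReal (∑' k, c k) :=
        (ENNReal.ofReal_tsum_of_nonneg (fun k => (hc0 k).le) hs).symm

/-- A first moment bound from below for the one-dimensional marginals. -/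
theorem exists_first_moment_bound : ∃ c : ℝ, 0 < c ∧ ∀ (n : ℕ) (P : Measure (Inst n))
    (q : Inst n → ENNReal), HasIsotropicDensity P q → ∀ u : Inst n, ‖u‖ = 1 →
      c ≤ ∫ x, |inner ℝ u x| ∂P := by
  obtain ⟨K, hK, hbound⟩ := exists_fourth_moment_bound
  -- From y² ≤ T|y| + y⁴/T², integration gives 1 ≤ T E|y| + K/T². This T makes the last term 1/2.
  set T := Real.sqrt (2 * K) with hT
  have hT0 : 0 < T := Real.sqrt_pos.2 (by positivity)
  have hT2 : T ^ 2 = 2 * K := Real.sq_sqrt (by positivity)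
  refine ⟨1 / (2 * T), by positivity, ?_⟩
  intro n P q h u hu
  have := h.isProbabilityMeasure
  have hL := h.memLp_inner u
  have h1 : ENNReal.ofReal 1 ≤ ENNReal.ofReal T * ENNReal.ofReal (∫ x, |inner ℝ u x| ∂P)
      + ENNReal.ofReal ((T ^ 2)⁻¹) * ENNReal.ofReal K := by
    rw [← h.integral_inner_sq hu, ofReal_integral_eq_lintegral_ofReal hL.integrable_sq
      (Filter.Eventually.of_forall fun x => sq_nonneg _),
      ofReal_integral_eq_lintegral_ofReal (hL.integrable one_le_two).abs
      (Filter.Eventually.of_forall fun x => abs_nonneg _)]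
    refine le_trans ?_ (add_le_add le_rfl (mul_le_mul_right (hbound n P q h u hu) _))
    rw [← lintegral_const_mul _ (by fun_prop), ← lintegral_const_mul _ (by fun_prop),
      ← lintegral_add_left (by fun_prop)]
    refine lintegral_mono fun x => ?_
    rw [← ENNReal.ofReal_mul hT0.le, ← ENNReal.ofReal_mul (by positivity),
      ← ENNReal.ofReal_add (by positivity) (by positivity)]
    refine ENNReal.ofReal_le_ofReal ?_
    set y : ℝ := inner ℝ u x
    rcases le_or_gt |y| T with hy | hy
    · have : y ^ 2 ≤ T * |y| := by
        rw [← sq_abs, sq]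
        gcongr
      have : 0 ≤ (T ^ 2)⁻¹ * y ^ 4 := by positivity
      linarith
    · have h2 : T ^ 2 ≤ y ^ 2 := by
        rw [← sq_abs y]
        gcongr
      have : y ^ 2 ≤ (T ^ 2)⁻¹ * y ^ 4 := by
        rw [inv_mul_eq_div, le_div_iff₀ (by positivity)]
        nlinarith [sq_nonneg y]
      have : 0 ≤ T * |y| := by positivity
      linarith
  have h0 : 0 ≤ ∫ x, |inner ℝ u x| ∂P := integral_nonneg fun x => abs_nonneg _
  rw [← ENNReal.ofReal_mul hT0.le, ← ENNReal.ofReal_mul (by positivity),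
    ← ENNReal.ofReal_add (by positivity) (by positivity),
    ENNReal.ofReal_le_ofReal_iff (by positivity), hT2] at h1
  have e : (2 * K)⁻¹ * K = 1 / 2 := by field_simp
  rw [e] at h1
  rw [div_le_iff₀ (by positivity)]
  linarith

/-- Halfspaces whose boundary is close to the mean have mass bounded from below. -/
theorem exists_halfspace_mass_bound : ∃ r c : ℝ, 0 < r ∧ 0 < c ∧ ∀ (n : ℕ)
    (P : Measure (Inst n)) (q : Inst n → ENNReal), HasIsotropicDensity P q →
      ∀ u : Inst n, ‖u‖ = 1 → c ≤ P.real {x | r ≤ inner ℝ u x} := by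
  obtain ⟨c, hc, hbound⟩ := exists_first_moment_bound
  refine ⟨c / 8, c ^ 2 / 8, by positivity, by positivity, ?_⟩
  intro n P q h u hu
  have := h.isProbabilityMeasure
  have hL := h.memLp_inner u
  have hI := hL.integrable one_le_two
  have h1 := hbound n P q h u hu
  have hm : MeasurableSet {x : Inst n | c / 8 ≤ inner ℝ u x} :=
    measurableSet_le measurable_const (by fun_prop)
  have hI1 : Integrable (fun x => c / 8 + c / 8 * (inner ℝ u x : ℝ) ^ 2) P :=
    (integrable_const _).add (hL.integrable_sq.const_mul _)
  -- The positive part of u·x has mean E|u·x|/2 ≥ c/2, as the mean vanishes. Where u·x ≥ c/8, the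
  -- pointwise bound is a completed square. The first two terms on the right integrate to c/4, which
  -- leaves c/4 for the halfspace.
  have h2 : ∫ x, (|inner ℝ u x| + inner ℝ u x) / 2 ∂P ≤ ∫ x, (c / 8
      + c / 8 * (inner ℝ u x) ^ 2
      + {x : Inst n | c / 8 ≤ inner ℝ u x}.indicator (fun _ => 2 / c) x) ∂P := by
    refine integral_mono ((hI.abs.add hI).div_const 2)
      (hI1.add ((integrable_const _).indicator hm)) fun x => ?_
    simp only
    by_cases hx : c / 8 ≤ inner ℝ u x
    · rw [Set.indicator_of_mem (by exact hx), abs_of_nonneg (by linarith)]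
      set y : ℝ := inner ℝ u x
      have h3 : 0 ≤ c / 8 * (y - 4 / c) ^ 2 := by positivity
      have e : c / 8 * (y - 4 / c) ^ 2 = c / 8 * y ^ 2 - y + 2 / c := by
        field_simp
        ring
      linarith
    · rw [Set.indicator_of_notMem (by exact hx)]
      have : 0 ≤ c / 8 * (inner ℝ u x : ℝ) ^ 2 := by positivity
      rcases abs_cases (inner ℝ u x : ℝ) with hh | hh <;> push Not at hx <;> linarith
  rw [integral_div, integral_add hI.abs hI, h.integral_inner,
    integral_add hI1 ((integrable_const _).indicator hm),
    integral_add (integrable_const _) (hL.integrable_sq.const_mul _), integral_const_mul,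
    h.integral_inner_sq hu, integral_indicator_const _ hm] at h2
  simp only [integral_const, probReal_univ, smul_eq_mul, one_mul, mul_one, add_zero] at h2
  have h3 : c / 4 ≤ P.real {x | c / 8 ≤ inner ℝ u x} * (2 / c) := by linarith
  rw [← div_le_iff₀ (by positivity)] at h3
  refine le_trans (le_of_eq ?_) h3
  field_simp
  norm_num

/-! ### Pointwise bounds for isotropic log-concave densities -/

theorem LogConcave.convex_superlevel {E : Type*} [AddCommGroup E] [Module ℝ E] {q : E → ENNReal}
    (hq : LogConcave q) (t : ENNReal) : Convex ℝ {x | t < q x} :=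
  convex_iff_forall_pos.2 fun _ hx _ hy _ _ ha hb hab =>
    (rpow_mul_rpow_lt ha hb hab hx hy).trans_le (hq _ _ _ _ ha hb hab)

/-- At every point, a log-concave function is at most its value there on some halfspace through
the point, up to a null set. -/
theorem LogConcave.exists_halfspace_ae_le {n : ℕ} [NeZero n] {q : Inst n → ENNReal}
    (hq : LogConcave q) (z : Inst n) :
    ∃ u : Inst n, ‖u‖ = 1 ∧
      ∀ᵐ x : Inst n, (inner ℝ u z : ℝ) ≤ inner ℝ u x → q x ≤ q z := by
  set K := {x | q z < q x} with hK
  have hconv : Convex ℝ K := hq.convex_superlevel _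
  -- Separation is only available from the interior; the frontier of a convex set is null, whence
  -- the almost everywhere statement.
  suffices ∃ u : Inst n, ‖u‖ = 1 ∧ ∀ x ∈ interior K, (inner ℝ u x : ℝ) < inner ℝ u z by
    obtain ⟨u, hu, h⟩ := this
    refine ⟨u, hu, ?_⟩
    filter_upwards [measure_eq_zero_iff_ae_notMem.1 (hconv.addHaar_frontier volume)] with x hx hxz
    by_contra! hlt
    exact hx ⟨subset_closure hlt, fun hi => absurd (h x hi) (not_lt.2 hxz)⟩
  have hz : z ∉ interior K := fun hz =>
    absurd (interior_subset (s := K) hz) (lt_irrefl (q z))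
  obtain ⟨f, hf⟩ := geometric_hahn_banach_open_point hconv.interior isOpen_interior hz
  set v := (InnerProductSpace.toDual ℝ (Inst n)).symm f with hv
  have hfv : ∀ x, f x = inner ℝ v x := fun x => by simp [hv]
  -- A zero separating functional means that the interior is empty, and then any unit vector works;
  -- one exists because n ≠ 0.
  by_cases hv0 : v = 0
  · refine ⟨EuclideanSpace.single 0 1, by simp, fun x hx => ?_⟩
    have := hf x hx
    simp [hfv, hv0] at this
  · refine ⟨‖v‖⁻¹ • v, norm_smul_inv_norm hv0, fun x hx => ?_⟩
    rw [real_inner_smul_left, real_inner_smul_left, ← hfv, ← hfv]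
    exact mul_lt_mul_of_pos_left (hf x hx) (by positivity)

namespace HasIsotropicDensity

variable {n : ℕ} {P : Measure (Inst n)} {q : Inst n → ENNReal}

theorem measure_real_le_norm_le (h : HasIsotropicDensity P q) {R : ℝ} (hR : 0 < R) :
    P.real {x | R ≤ ‖x‖} ≤ n / R ^ 2 := by
  have := h.isProbabilityMeasure
  have hsq : ∀ x : Inst n, ‖x‖ ^ 2
      = ∑ i, (inner ℝ (EuclideanSpace.single i 1 : Inst n) x : ℝ) ^ 2 := by
    intro x
    simp [EuclideanSpace.norm_sq_eq, EuclideanSpace.inner_single_left]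
  have hI := fun i : Fin n => (h.memLp_inner (EuclideanSpace.single i 1)).integrable_sq
  have hint : ∫ x, ‖x‖ ^ 2 ∂P = n := by
    simp_rw [hsq]
    rw [integral_finsetSum _ fun i _ => hI i]
    simp_rw [h.integral_inner_sq (u := EuclideanSpace.single _ (1 : ℝ)) (by simp)]
    simp
  have h1 := mul_meas_ge_le_integral_of_nonneg (μ := P) (f := fun x => ‖x‖ ^ 2)
    (Filter.Eventually.of_forall fun x => sq_nonneg _) (by
      simp_rw [hsq]
      exact integrable_finsetSum _ fun i _ => hI i) (R ^ 2)
  rw [hint] at h1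
  have hset : {x : Inst n | R ≤ ‖x‖} = {x | R ^ 2 ≤ ‖x‖ ^ 2} := by
    ext x
    exact (pow_le_pow_iff_left₀ hR.le (norm_nonneg _) two_ne_zero).symm
  rwa [hset, le_div_iff₀ (by positivity), mul_comm]

end HasIsotropicDensity

/-- Isotropic log-concave densities are bounded from below near the mean. -/
theorem exists_density_lower_bound (n : ℕ) [NeZero n] : ∃ r c : ℝ, 0 < r ∧ 0 < c ∧
    ∀ (P : Measure (Inst n)) (q : Inst n → ENNReal), HasIsotropicDensity P q →
      ∀ z : Inst n, ‖z‖ ≤ r → ENNReal.ofReal c ≤ q z := by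
  obtain ⟨r, c₀, hr, hc₀, hhalf⟩ := exists_halfspace_mass_bound
  -- Chebyshev's inequality leaves mass at most c₀/2 outside this ball. So the halfspace has mass at
  -- least c₀/2 inside it, which a density below c₀/(4V) there cannot provide.
  set R : ℝ := Real.sqrt (2 * n / c₀) with hR
  have hn : (0 : ℝ) < n := by exact_mod_cast NeZero.pos n
  have hR0 : 0 < R := Real.sqrt_pos.2 (by positivity)
  have hR2 : n / R ^ 2 = c₀ / 2 := by
    rw [hR, Real.sq_sqrt (by positivity)]
    field_simp
  set V : ℝ := volume.real (Metric.ball (0 : Inst n) R) with hV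
  have hV0 : 0 < V :=
    ENNReal.toReal_pos (Metric.measure_ball_pos _ _ hR0).ne' measure_ball_lt_top.ne
  refine ⟨r, c₀ / (4 * V), hr, by positivity, ?_⟩
  intro P q h z hz
  have := h.isProbabilityMeasure
  by_contra! hlt
  obtain ⟨u, hu, hae⟩ := h.logConcave.exists_halfspace_ae_le z
  have huz : inner ℝ u z ≤ r := by
    have := real_inner_le_norm u z
    rw [hu, one_mul] at this
    exact this.trans hz
  have h1 := hhalf n P q h u hu
  have hms : MeasurableSet {x : Inst n | r ≤ inner ℝ u x} :=
    measurableSet_le measurable_const (by fun_prop)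
  have h2 : P.real ({x | r ≤ inner ℝ u x} ∩ Metric.ball 0 R) ≤ c₀ / 4 := by
    refine ENNReal.toReal_le_of_le_ofReal (by positivity) ?_
    calc P ({x | r ≤ inner ℝ u x} ∩ Metric.ball 0 R)
        = ∫⁻ x in {x | r ≤ inner ℝ u x} ∩ Metric.ball 0 R, q x := by
          rw [h.eq_withDensity, withDensity_apply _ (hms.inter measurableSet_ball)]
      _ ≤ ∫⁻ x in {x | r ≤ inner ℝ u x} ∩ Metric.ball 0 R, ENNReal.ofReal (c₀ / (4 * V)) := by
          refine setLIntegral_mono_ae' (hms.inter measurableSet_ball) ?_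
          filter_upwards [hae] with x hx hx'
          exact (hx (huz.trans hx'.1)).trans hlt.le
      _ ≤ ENNReal.ofReal (c₀ / (4 * V)) * volume (Metric.ball (0 : Inst n) R) := by
          rw [setLIntegral_const]
          gcongr
          exact Set.inter_subset_right
      _ = ENNReal.ofReal (c₀ / 4) := by
          rw [← ofReal_measureReal measure_ball_lt_top.ne, ← hV,
            ← ENNReal.ofReal_mul (by positivity)]
          congr 1
          field_simp
  have h3 := h.measure_real_le_norm_le hR0
  have h4 : P.real {x | r ≤ inner ℝ u x}
      ≤ P.real ({x | r ≤ inner ℝ u x} ∩ Metric.ball 0 R) + P.real {x | R ≤ ‖x‖} := by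
    refine (measureReal_mono fun x hx => ?_).trans (measureReal_union_le _ _)
    rcases lt_or_ge ‖x‖ R with hxR | hxR
    · exact Or.inl ⟨hx, by simpa using hxR⟩
    · exact Or.inr hxR
  linarith

/-- Isotropic log-concave densities are bounded and decay polynomially. -/
theorem exists_density_upper_bound (n : ℕ) [NeZero n] : ∃ M : ℝ, 0 < M ∧
    ∀ (P : Measure (Inst n)) (q : Inst n → ENNReal), HasIsotropicDensity P q →
      ∀ z : Inst n, q z ≤ ENNReal.ofReal M ∧ (z ≠ 0 → q z ≤ ENNReal.ofReal (M / ‖z‖ ^ 4)) := by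
  obtain ⟨r, c, hr, hc, hlow⟩ := exists_density_lower_bound n
  set V : ℝ := volume.real (Metric.ball (0 : Inst n) (r / 2)) with hV
  have hV0 : 0 < V :=
    ENNReal.toReal_pos (Metric.measure_ball_pos _ _ (by positivity)).ne' measure_ball_lt_top.ne
  set D := V ^ 2 * c with hD
  have hD0 : 0 < D := by positivity
  -- The three summands serve the uniform bound, the decay for ‖z‖ ≤ 2r and the decay for ‖z‖ > 2r.
  refine ⟨(1 + 16 * r ^ 4 + (16 * n) ^ 2) / D, by positivity, ?_⟩
  intro P q h z
  have := h.isProbabilityMeasure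
  -- Points of B are midpoints of z and a point of norm at most r, where the density is at least c.
  -- So q ≥ √(c q(z)) on B, and P(B) ≤ 1 bounds q(z). For ‖z‖ > 2r the ball B lies in ‖x‖ ≥ ‖z‖/4,
  -- and squaring the Chebyshev bound for P(B) yields the fourth power.
  set B := Metric.ball ((1 / 2 : ℝ) • z) (r / 2) with hB
  have hmass : q z ≤ ENNReal.ofReal (P.real B ^ 2 / D) := by
    have h1 : ENNReal.ofReal V * (q z ^ (1 / 2 : ℝ) * ENNReal.ofReal c ^ (1 / 2 : ℝ)) ≤ P B := by
      rw [h.eq_withDensity, withDensity_apply _ measurableSet_ball, hV,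
        ofReal_measureReal measure_ball_lt_top.ne, ← Measure.addHaar_ball_center volume
          ((1 / 2 : ℝ) • z), mul_comm, ← setLIntegral_const]
      refine setLIntegral_mono' measurableSet_ball fun x hx => ?_
      have hx' : x = (1 / 2 : ℝ) • z + (1 / 2 : ℝ) • ((2 : ℝ) • x - z) := by
        rw [smul_sub, smul_smul]
        norm_num
      have hy : ‖(2 : ℝ) • x - z‖ ≤ r := by
        have : (2 : ℝ) • x - z = (2 : ℝ) • (x - (1 / 2 : ℝ) • z) := by
          rw [smul_sub, smul_smul]
          norm_num
        rw [this, norm_smul]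
        rw [Metric.mem_ball, dist_eq_norm] at hx
        norm_num
        linarith
      refine le_trans ?_ ((h.logConcave z ((2 : ℝ) • x - z) (1 / 2) (1 / 2) (by norm_num)
        (by norm_num) (by norm_num)).trans_eq (by rw [← hx']))
      gcongr
      exact hlow P q h _ hy
    have h2 : ENNReal.ofReal D * q z ≤ ENNReal.ofReal (P.real B ^ 2) := by
      have hs : ∀ x : ENNReal, (x ^ (1 / 2 : ℝ)) ^ 2 = x := by
        intro x
        rw [← ENNReal.rpow_natCast, ← ENNReal.rpow_mul]
        norm_num
      have h3 := pow_le_pow_left' h1 2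
      rw [mul_pow, mul_pow, hs, hs, ← ofReal_measureReal, ← ENNReal.ofReal_pow (by positivity),
        ← ENNReal.ofReal_pow (by positivity)] at h3
      refine le_trans (le_of_eq ?_) h3
      rw [hD, ENNReal.ofReal_mul (by positivity)]
      ring
    rw [ENNReal.ofReal_div_of_pos hD0, ENNReal.le_div_iff_mul_le (by simp [hD0]) (by simp),
      mul_comm]
    exact h2
  have hn : 0 ≤ (16 * (n : ℝ)) ^ 2 := by positivity
  have hone : q z ≤ ENNReal.ofReal (1 / D) := by
    refine hmass.trans (ENNReal.ofReal_le_ofReal ?_)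
    gcongr
    exact pow_le_one₀ measureReal_nonneg measureReal_le_one
  refine ⟨hone.trans (ENNReal.ofReal_le_ofReal ?_), fun hz => ?_⟩
  · gcongr
    have : 0 < r ^ 4 := by positivity
    linarith
  have hz0 : 0 < ‖z‖ := norm_pos_iff.2 hz
  rcases le_or_gt ‖z‖ (2 * r) with hzr | hzr
  · refine hone.trans (ENNReal.ofReal_le_ofReal ?_)
    rw [div_div, div_le_div_iff₀ hD0 (by positivity)]
    have h5 : ‖z‖ ^ 4 ≤ 16 * r ^ 4 := by
      calc ‖z‖ ^ 4 ≤ (2 * r) ^ 4 := by gcongr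
        _ = _ := by ring
    nlinarith
  · refine hmass.trans (ENNReal.ofReal_le_ofReal ?_)
    have h6 : P.real B ≤ 16 * n / ‖z‖ ^ 2 := by
      have h7 := h.measure_real_le_norm_le (R := ‖z‖ / 4) (by positivity)
      have e : (n : ℝ) / (‖z‖ / 4) ^ 2 = 16 * n / ‖z‖ ^ 2 := by
        field_simp
        norm_num
      rw [e] at h7
      refine (measureReal_mono fun x hx => ?_).trans h7
      rw [hB, Metric.mem_ball, dist_eq_norm] at hx
      have h8 := norm_sub_norm_le ((1 / 2 : ℝ) • z) x
      rw [norm_sub_rev, norm_smul] at h8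
      norm_num at h8
      change ‖z‖ / 4 ≤ ‖x‖
      linarith
    calc P.real B ^ 2 / D ≤ (16 * n / ‖z‖ ^ 2) ^ 2 / D := by gcongr
      _ = (16 * n) ^ 2 / D / ‖z‖ ^ 4 := by field_simp
      _ ≤ _ := by
        gcongr
        have : 0 < r ^ 4 := by positivity
        linarith

/-! ### Disagreement of two halfspaces as a planar double wedge -/

/-- The planar region in which the signs of the linear forms with normals at the angles `π / 2`
and `π / 2 + θ` differ. -/
def wedge (θ : ℝ) : Set (Inst 2) :=
  {z | ¬(0 ≤ z 1 ↔ 0 ≤ -Real.sin θ * z 0 + Real.cos θ * z 1)}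

theorem measurableSet_wedge (θ : ℝ) : MeasurableSet (wedge θ) := by
  have h1 : MeasurableSet {z : Inst 2 | 0 ≤ z 1} :=
    measurableSet_le measurable_const (by fun_prop)
  have h2 : MeasurableSet {z : Inst 2 | 0 ≤ -Real.sin θ * z 0 + Real.cos θ * z 1} :=
    measurableSet_le measurable_const (by fun_prop)
  exact (h1.iff h2).compl

/-- Two forms with different signs at z are each at most their difference in absolute value, and the
difference of the unit normals has squared norm 2 - 2 cos θ ≤ θ². -/
theorem abs_coord_le_of_mem_wedge {θ : ℝ} (hθ : 0 ≤ θ) {z : Inst 2} (hz : z ∈ wedge θ) :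
    |z 1| ≤ θ * ‖z‖ := by
  set s := Real.sin θ
  set k := Real.cos θ
  have h1 : |z 1| ≤ |-s * z 0 + (k - 1) * z 1| := by
    have hz' : ¬(0 ≤ z 1 ↔ 0 ≤ -s * z 0 + k * z 1) := hz
    by_cases h0 : 0 ≤ z 1
    · have h2 : ¬ 0 ≤ -s * z 0 + k * z 1 := fun h => hz' ⟨fun _ => h, fun _ => h0⟩
      rw [abs_of_nonneg h0]
      exact le_trans (by linarith) (neg_le_abs _)
    · have h2 : 0 ≤ -s * z 0 + k * z 1 := by
        by_contra h
        exact hz' ⟨fun h' => absurd h' h0, fun h' => absurd h' h⟩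
      rw [abs_of_neg (not_le.1 h0)]
      exact le_trans (by linarith) (le_abs_self _)
  refine h1.trans (abs_le_of_sq_le_sq ?_ (by positivity))
  have hcos : 1 - θ ^ 2 / 2 ≤ k := Real.one_sub_sq_div_two_le_cos
  have hsc : s ^ 2 + k ^ 2 = 1 := Real.sin_sq_add_cos_sq θ
  have hn : ‖z‖ ^ 2 = z 0 ^ 2 + z 1 ^ 2 := by simp [EuclideanSpace.norm_sq_eq]
  rw [mul_pow, hn]
  calc (-s * z 0 + (k - 1) * z 1) ^ 2 ≤ (s ^ 2 + (k - 1) ^ 2) * (z 0 ^ 2 + z 1 ^ 2) := by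
        nlinarith [sq_nonneg ((k - 1) * z 0 + s * z 1)]
    _ ≤ θ ^ 2 * (z 0 ^ 2 + z 1 ^ 2) := by
        gcongr
        nlinarith

open Set in
theorem mem_wedge_polar {θ : ℝ} (hθ0 : 0 ≤ θ) (hθ : θ < Real.pi) {r φ : ℝ} (hr : 0 < r)
    (hφ : φ ∈ Ioo (-Real.pi) Real.pi) :
    (WithLp.toLp 2 ![r * Real.cos φ, r * Real.sin φ] : Inst 2) ∈ wedge θ ↔
      φ ∈ Ico 0 θ ∪ Ioc (-Real.pi) (θ - Real.pi) := by
  have e : -Real.sin θ * (r * Real.cos φ) + Real.cos θ * (r * Real.sin φ)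
      = r * Real.sin (φ - θ) := by
    rw [Real.sin_sub]; ring
  have hpi := Real.pi_pos
  simp only [wedge, mem_ofPred_eq, Matrix.cons_val_zero, Matrix.cons_val_one, e,
    mul_nonneg_iff_of_pos_left hr, mem_union, mem_Ico, mem_Ioc]
  obtain ⟨hφ1, hφ2⟩ := hφ
  rcases le_or_gt 0 φ with h0 | h0
  · have h1 : 0 ≤ Real.sin φ := Real.sin_nonneg_of_nonneg_of_le_pi h0 hφ2.le
    rcases lt_or_ge φ θ with h2 | h2
    · have h3 : ¬ 0 ≤ Real.sin (φ - θ) :=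
        not_le.2 (Real.sin_neg_of_neg_of_neg_pi_lt (by linarith) (by linarith))
      simp [h1, h3, h0, h2]
    · have h3 : 0 ≤ Real.sin (φ - θ) :=
        Real.sin_nonneg_of_nonneg_of_le_pi (by linarith) (by linarith)
      simp only [h1, h3, not_true_eq_false, false_iff]
      rintro (h | h) <;> linarith [h.1, h.2]
  · have h1 : ¬ 0 ≤ Real.sin φ := not_le.2 (Real.sin_neg_of_neg_of_neg_pi_lt h0 hφ1)
    have h4 : Real.sin (φ - θ) = - Real.sin (φ - θ + Real.pi) := by rw [Real.sin_add_pi]; ring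
    rcases le_or_gt φ (θ - Real.pi) with h2 | h2
    · have h3 : 0 ≤ Real.sin (φ - θ) := by
        rw [h4, ← Real.sin_neg]
        exact Real.sin_nonneg_of_nonneg_of_le_pi (by linarith) (by linarith)
      simp [h1, h3, hφ1, h2]
    · have h3 : ¬ 0 ≤ Real.sin (φ - θ) := by
        rw [h4]
        have := Real.sin_pos_of_pos_of_lt_pi (x := φ - θ + Real.pi) (by linarith) (by linarith)
        linarith
      simp only [h1, h3, not_true_eq_false, false_iff]
      rintro (h | h) <;> linarith [h.1, h.2]

open Set in
/-- The integral of a radial function over a wedge. -/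
theorem setLIntegral_wedge {θ : ℝ} (hθ0 : 0 ≤ θ) (hθ : θ < Real.pi) {f : ℝ → ENNReal}
    (hf : Measurable f) :
    ∫⁻ z in wedge θ, f ‖z‖
      = ENNReal.ofReal (2 * θ) * ∫⁻ r in Ioi (0 : ℝ), ENNReal.ofReal r * f r := by
  have hpi := Real.pi_pos
  let ψ : ℝ × ℝ → Inst 2 := fun p => WithLp.toLp 2 ![p.1, p.2]
  have hψ : MeasurePreserving ψ volume volume :=
    (PiLp.volume_preserving_toLp (Fin 2)).comp (volume_preserving_finTwoArrow ℝ).symm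
  have hF : Measurable ((wedge θ).indicator fun z => f ‖z‖) :=
    (hf.comp measurable_norm).indicator (measurableSet_wedge θ)
  rw [← lintegral_indicator (measurableSet_wedge θ), ← hψ.lintegral_comp hF,
    ← lintegral_comp_polarCoord_symm]
  set A := Ico 0 θ ∪ Ioc (-Real.pi) (θ - Real.pi) with hA
  have hAm : MeasurableSet A := measurableSet_Ico.union measurableSet_Ioc
  have hvol : volume.restrict (Ioo (-Real.pi) Real.pi) A = ENNReal.ofReal (2 * θ) := by
    have hae : Ioo (-Real.pi) Real.pi =ᵐ[volume] Ioc (-Real.pi) Real.pi := Ioo_ae_eq_Ioc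
    rw [Measure.restrict_congr_set hae, Measure.restrict_apply hAm]
    have hsub : A ∩ Ioc (-Real.pi) Real.pi = A := by
      refine inter_eq_left.2 ?_
      rintro x (hx | hx)
      · exact ⟨by linarith [hx.1], by linarith [hx.2]⟩
      · exact ⟨hx.1, by linarith [hx.2]⟩
    rw [hsub, hA, measure_union _ measurableSet_Ioc, Real.volume_Ico, Real.volume_Ioc,
      ← ENNReal.ofReal_add (by linarith) (by linarith)]
    · congr 1; ring
    · rw [Set.disjoint_left]
      rintro x hx hx'
      linarith [hx.1, hx'.2]
  rw [polarCoord_target]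
  have hcongr : ∫⁻ p in Ioi (0 : ℝ) ×ˢ Ioo (-Real.pi) Real.pi,
      ENNReal.ofReal p.1 • (wedge θ).indicator (fun z => f ‖z‖) (ψ (polarCoord.symm p))
      = ∫⁻ p in Ioi (0 : ℝ) ×ˢ Ioo (-Real.pi) Real.pi,
        (ENNReal.ofReal p.1 * f p.1) * A.indicator 1 p.2 := by
    refine setLIntegral_congr_fun (measurableSet_Ioi.prod measurableSet_Ioo) ?_
    rintro ⟨r, φ⟩ ⟨hr, hφ⟩
    simp only at hr hφ
    have hm := mem_wedge_polar hθ0 hθ hr hφ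
    have hnorm : ‖(WithLp.toLp 2 ![r * Real.cos φ, r * Real.sin φ] : Inst 2)‖ = r := by
      rw [← sq_eq_sq₀ (norm_nonneg _) (le_of_lt hr), EuclideanSpace.norm_sq_eq]
      simp only [Fin.sum_univ_two, Real.norm_eq_abs, sq_abs, Matrix.cons_val_zero,
        Matrix.cons_val_one]
      linear_combination r ^ 2 * Real.sin_sq_add_cos_sq φ
    simp only [polarCoord_symm_apply, ψ, smul_eq_mul]
    by_cases h : φ ∈ A
    · rw [indicator_of_mem (hm.2 h), indicator_of_mem h, hnorm]
      simp
    · rw [indicator_of_notMem (fun h' => h (hm.1 h')), indicator_of_notMem h]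
      simp
  rw [hcongr, Measure.volume_eq_prod, ← Measure.prod_restrict, lintegral_prod_mul
    (f := fun r => ENNReal.ofReal r * f r) (g := A.indicator 1) (by fun_prop)
    (measurable_one.indicator hAm).aemeasurable,
    lintegral_indicator_one hAm, hvol, mul_comm]

/-- A frame of the plane spanned by two unit vectors. -/
theorem exists_frame {d : ℕ} {w w' : UnitVec d} (h0 : 0 < theta w w') (hpi : theta w w' < Real.pi) :
    ∃ v : Fin 2 → Inst d, Orthonormal ℝ v ∧ v 1 = w ∧
      ∀ x, (inner ℝ (w' : Inst d) x : ℝ)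
        = -Real.sin (theta w w') * inner ℝ (v 0) x + Real.cos (theta w w') * inner ℝ (v 1) x := by
  set θ := theta w w' with hθ
  have hw : ‖(w : Inst d)‖ = 1 := by simp
  have hw' : ‖(w' : Inst d)‖ = 1 := by simp
  have hin : (inner ℝ (w : Inst d) (w' : Inst d) : ℝ) = Real.cos θ := by
    rw [hθ, theta, cos_angle, hw, hw']
    simp
  have hs : 0 < Real.sin θ := Real.sin_pos_of_pos_of_lt_pi h0 hpi
  -- Gram–Schmidt, with the sign chosen so that w' = -sin θ e + cos θ w, matching `wedge`.
  set e : Inst d := (Real.sin θ)⁻¹ • (Real.cos θ • (w : Inst d) - (w' : Inst d)) with he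
  have hew : (inner ℝ e (w : Inst d) : ℝ) = 0 := by
    rw [he, real_inner_smul_left, inner_sub_left, real_inner_smul_left,
      real_inner_self_eq_norm_sq, hw, real_inner_comm, hin]
    ring
  have hen : ‖e‖ = 1 := by
    rw [← sq_eq_sq₀ (norm_nonneg _) zero_le_one, he, norm_smul, mul_pow, norm_sub_sq_real,
      norm_smul, hw, hw', real_inner_smul_left, hin, norm_inv, inv_pow, Real.norm_eq_abs,
      sq_abs, Real.norm_eq_abs, mul_one, sq_abs, Real.sin_sq]
    have : 1 - Real.cos θ ^ 2 ≠ 0 := by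
      rw [← Real.sin_sq]
      positivity
    field_simp
    ring
  refine ⟨![e, w], ?_, rfl, fun x => ?_⟩
  · rw [orthonormal_iff_ite]
    intro i j
    fin_cases i <;> fin_cases j <;>
      simp [hew, hen, hw, real_inner_comm (e : Inst d) (w : Inst d)]
  · have hs' := hs.ne'
    simp only [he, Matrix.cons_val_zero, Matrix.cons_val_one, real_inner_smul_left,
      inner_sub_left]
    field_simp
    ring

theorem halfspace_ne_iff {d : ℕ} (w w' : UnitVec d) (x : Inst d) :
    halfspace w x ≠ halfspace w' x ↔
      ¬(0 ≤ (inner ℝ (w : Inst d) x : ℝ) ↔ 0 ≤ (inner ℝ (w' : Inst d) x : ℝ)) := by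
  unfold halfspace
  have h : ((⟨1, Or.inl rfl⟩ : Label) = ⟨-1, Or.inr rfl⟩) ↔ False := by
    simp only [Subtype.mk.injEq, iff_false]
    norm_num
  have h' : ((⟨-1, Or.inr rfl⟩ : Label) = ⟨1, Or.inl rfl⟩) ↔ False := by
    rw [eq_comm, h]
  split_ifs with h1 h2 h2 <;> simp [h1, h2, h, h']

theorem halfspace_ne_iff_coords_mem_wedge {d : ℕ} {w w' : UnitVec d} {v : Fin 2 → Inst d}
    (hv1 : v 1 = w) (hv : ∀ x, (inner ℝ (w' : Inst d) x : ℝ)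
        = -Real.sin (theta w w') * inner ℝ (v 0) x + Real.cos (theta w w') * inner ℝ (v 1) x)
    (x : Inst d) : halfspace w x ≠ halfspace w' x ↔ coords v x ∈ wedge (theta w w') := by
  rw [halfspace_ne_iff, hv, ← hv1]
  rfl

theorem theta_nonneg {d : ℕ} (w w' : UnitVec d) : 0 ≤ theta w w' := angle_nonneg _ _

theorem theta_le_pi {d : ℕ} (w w' : UnitVec d) : theta w w' ≤ Real.pi := angle_le_pi _ _

theorem cos_theta {d : ℕ} (w w' : UnitVec d) :
    Real.cos (theta w w') = inner ℝ (w : Inst d) (w' : Inst d) := by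
  have hw : ‖(w : Inst d)‖ = 1 := by simp
  have hw' : ‖(w' : Inst d)‖ = 1 := by simp
  rw [theta, cos_angle, hw, hw']
  simp

theorem eq_of_theta_eq_zero {d : ℕ} {w w' : UnitVec d} (h : theta w w' = 0) : w = w' := by
  have h1 := cos_theta w w'
  rw [h, Real.cos_zero] at h1
  exact Subtype.ext ((inner_eq_one_iff_of_norm_eq_one (by simp)
    (by simp)).1 h1.symm)

theorem eq_neg_of_theta_eq_pi {d : ℕ} {w w' : UnitVec d} (h : theta w w' = Real.pi) :
    (w : Inst d) = -w' := by
  have h1 := cos_theta w w'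
  rw [h, Real.cos_pi] at h1
  refine (inner_eq_one_iff_of_norm_eq_one (𝕜 := ℝ) (by simp) (by simp)).1 ?_
  rw [inner_neg_right, ← h1]
  norm_num

/-! ### Existence of valid constants -/

/-- Bands have mass at most proportional to their width. -/
theorem exists_band_bound : ∃ C : ℝ, 0 < C ∧ ∀ (d : ℕ) (P : Measure (Inst d)),
    IsIsotropicLogConcave P → ∀ w : UnitVec d, ∀ γ : ℝ, 0 ≤ γ →
      P.real {x | |inner ℝ x (w : Inst d)| ≤ γ} ≤ C * γ := by
  obtain ⟨M, hM, hbound⟩ := exists_density_upper_bound 1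
  refine ⟨2 * M, by positivity, ?_⟩
  intro d P hP w γ hγ
  obtain ⟨q, hq⟩ := hP.exists_hasIsotropicDensity
  have hv : Orthonormal ℝ (fun _ : Fin 1 => (w : Inst d)) := by
    rw [orthonormal_iff_ite]
    intro i j
    simp [Subsingleton.elim i j]
  obtain ⟨q', hq'⟩ := hq.map_coords hv
  have hm : MeasurableSet {z : Inst 1 | |z 0| ≤ γ} :=
    measurableSet_le (by fun_prop) measurable_const
  have e : {x : Inst d | |inner ℝ x (w : Inst d)| ≤ γ}
      = coords (fun _ : Fin 1 => (w : Inst d)) ⁻¹' {z : Inst 1 | |z 0| ≤ γ} := by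
    ext x
    simp [coords, real_inner_comm]
  rw [e, ← map_measureReal_apply (continuous_coords _).measurable hm]
  refine ENNReal.toReal_le_of_le_ofReal (by positivity) ?_
  have hvol : volume {z : Inst 1 | |z 0| ≤ γ} = ENNReal.ofReal (2 * γ) := by
    rw [← (PiLp.volume_preserving_toLp (Fin 1)).measure_preimage hm.nullMeasurableSet]
    have : WithLp.toLp 2 ⁻¹' {z : Inst 1 | |z 0| ≤ γ}
        = Set.Icc (fun _ : Fin 1 => -γ) (fun _ => γ) := by
      ext z
      simp [Pi.le_def, abs_le]
    rw [this, Real.volume_Icc_pi]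
    simp [two_mul]
  rw [hq'.eq_withDensity, withDensity_apply _ hm]
  calc ∫⁻ z in {z : Inst 1 | |z 0| ≤ γ}, q' z
      ≤ ∫⁻ z in {z : Inst 1 | |z 0| ≤ γ}, ENNReal.ofReal M :=
        lintegral_mono fun z => (hbound _ _ hq' z).1
    _ = ENNReal.ofReal (2 * M * γ) := by
        rw [setLIntegral_const, hvol, ← ENNReal.ofReal_mul hM.le]
        congr 1
        ring

-- In polar coordinates the decay ‖z‖⁻⁴ carries the weight r, so the radial integral converges and
-- its tail is of order R⁻².
open Set in
theorem setLIntegral_Ioi_inv_cube {M R : ℝ} (hM : 0 ≤ M) (hR : 0 < R) :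
    ∫⁻ r in Ioi R, ENNReal.ofReal r * ENNReal.ofReal (M / r ^ 4)
      = ENNReal.ofReal (M / (2 * R ^ 2)) := by
  have hint : IntegrableOn (fun r : ℝ => r ^ (-3 : ℝ)) (Ioi R) :=
    integrableOn_Ioi_rpow_of_lt (by norm_num) hR
  have hval := integral_Ioi_rpow_of_lt (a := -3) (by norm_num) hR
  have e : ∫⁻ r in Ioi R, ENNReal.ofReal r * ENNReal.ofReal (M / r ^ 4)
      = ∫⁻ r in Ioi R, ENNReal.ofReal (M * r ^ (-3 : ℝ)) := by
    refine setLIntegral_congr_fun measurableSet_Ioi fun r hr => ?_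
    have hr0 : 0 < r := hR.trans hr
    rw [← ENNReal.ofReal_mul hr0.le, Real.rpow_neg hr0.le]
    congr 1
    rw [show (3 : ℝ) = (3 : ℕ) by norm_num, Real.rpow_natCast]
    field_simp
  rw [e, ← ofReal_integral_eq_lintegral_ofReal (hint.const_mul M), integral_const_mul, hval]
  · congr 1
    rw [show (-3 + 1 : ℝ) = -((2 : ℕ) : ℝ) by norm_num, Real.rpow_neg hR.le, Real.rpow_natCast]
    field_simp
    norm_num
  · filter_upwards [self_mem_ae_restrict measurableSet_Ioi] with r hr
    have hr0 : 0 < r := hR.trans hr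
    simp only [Pi.zero_apply]
    positivity

-- Only radii in (r/2, r] are used: there the density is at least c and the polar weight at least
-- r/2, so no radial integral has to be evaluated.
open Set in
theorem exists_wedge_lower_bound : ∃ c : ℝ, 0 < c ∧ ∀ (P : Measure (Inst 2))
    (q : Inst 2 → ENNReal), HasIsotropicDensity P q → ∀ θ : ℝ, 0 ≤ θ → θ < Real.pi →
      c * θ ≤ P.real (wedge θ) := by
  obtain ⟨r, c, hr, hc, hbound⟩ := exists_density_lower_bound 2
  refine ⟨c * r ^ 2 / 2, by positivity, ?_⟩
  intro P q h θ hθ0 hθ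
  have := h.isProbabilityMeasure
  refine (ENNReal.ofReal_le_iff_le_toReal (measure_ne_top _ _)).1 ?_
  have hm : Measurable ((Iic r).indicator fun _ => ENNReal.ofReal c) :=
    measurable_const.indicator measurableSet_Iic
  calc ENNReal.ofReal (c * r ^ 2 / 2 * θ)
      = ENNReal.ofReal (2 * θ) * (ENNReal.ofReal (r / 2 * c) * volume (Ioc (r / 2) r)) := by
        rw [Real.volume_Ioc, ← ENNReal.ofReal_mul (by positivity),
          ← ENNReal.ofReal_mul (by positivity)]
        congr 1
        ring
    _ ≤ ENNReal.ofReal (2 * θ) * ∫⁻ s in Ioi (0 : ℝ),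
          ENNReal.ofReal s * (Iic r).indicator (fun _ => ENNReal.ofReal c) s := by
        gcongr
        rw [← setLIntegral_const]
        refine le_trans (setLIntegral_mono' measurableSet_Ioc fun s hs => ?_)
          (lintegral_mono_set (fun s hs => lt_trans (by positivity) hs.1 : Ioc (r / 2) r ⊆ Ioi 0))
        rw [indicator_of_mem (by exact hs.2), ENNReal.ofReal_mul (by positivity)]
        gcongr
        exact hs.1.le
    _ = ∫⁻ z in wedge θ, (Iic r).indicator (fun _ => ENNReal.ofReal c) ‖z‖ :=
        (setLIntegral_wedge hθ0 hθ hm).symm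
    _ ≤ ∫⁻ z in wedge θ, q z := by
        refine lintegral_mono fun z => ?_
        by_cases hz : ‖z‖ ≤ r
        · rw [indicator_of_mem (by exact hz)]
          exact hbound P q h z hz
        · rw [indicator_of_notMem (by exact hz)]
          exact bot_le
    _ = P (wedge θ) := by rw [h.eq_withDensity, withDensity_apply _ (measurableSet_wedge θ)]

-- Radii up to 1 are covered by boundedness of the density (2Mθ) and larger ones by its decay (Mθ).
-- The separate tail bound, small for large R, controls the disagreement outside a band.
open Set in
theorem exists_wedge_upper_bound : ∃ M : ℝ, 0 < M ∧ ∀ (P : Measure (Inst 2))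
    (q : Inst 2 → ENNReal), HasIsotropicDensity P q → ∀ θ : ℝ, 0 ≤ θ → θ < Real.pi →
      P.real (wedge θ) ≤ 3 * M * θ ∧
      ∀ R : ℝ, 0 < R → P.real (wedge θ ∩ {z | R ≤ ‖z‖}) ≤ M / R ^ 2 * θ := by
  obtain ⟨M, hM, hbound⟩ := exists_density_upper_bound 2
  refine ⟨M, hM, ?_⟩
  intro P q h θ hθ0 hθ
  have := h.isProbabilityMeasure
  have htail : ∀ R : ℝ, 0 < R →
      P (wedge θ ∩ {z | R ≤ ‖z‖}) ≤ ENNReal.ofReal (M / R ^ 2 * θ) := by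
    intro R hR
    have hmR : MeasurableSet {z : Inst 2 | R ≤ ‖z‖} :=
      measurableSet_le measurable_const measurable_norm
    have hm : Measurable ((Ici R).indicator fun s : ℝ => ENNReal.ofReal (M / s ^ 4)) :=
      Measurable.indicator (by fun_prop) measurableSet_Ici
    calc P (wedge θ ∩ {z | R ≤ ‖z‖}) = ∫⁻ z in wedge θ, {z | R ≤ ‖z‖}.indicator q z := by
          rw [setLIntegral_indicator hmR, h.eq_withDensity,
            withDensity_apply _ ((measurableSet_wedge θ).inter hmR), inter_comm]
      _ ≤ ∫⁻ z in wedge θ, (Ici R).indicator (fun s : ℝ => ENNReal.ofReal (M / s ^ 4)) ‖z‖ := by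
          refine lintegral_mono fun z => ?_
          by_cases hz : R ≤ ‖z‖
          · rw [indicator_of_mem (by exact hz), indicator_of_mem (by exact hz)]
            exact (hbound P q h z).2 (norm_pos_iff.1 (hR.trans_le hz))
          · rw [indicator_of_notMem (by exact hz)]
            exact bot_le
      _ = ENNReal.ofReal (2 * θ) * ∫⁻ s in Ioi (0 : ℝ), ENNReal.ofReal s
            * (Ici R).indicator (fun s : ℝ => ENNReal.ofReal (M / s ^ 4)) s :=
          setLIntegral_wedge hθ0 hθ hm
      _ = ENNReal.ofReal (2 * θ) * ∫⁻ s in Ioi R, ENNReal.ofReal s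
            * ENNReal.ofReal (M / s ^ 4) := by
          congr 1
          simp_rw [← indicator_mul_right _ (fun s : ℝ => ENNReal.ofReal s)]
          rw [setLIntegral_indicator measurableSet_Ici,
            inter_eq_left.2 (Ici_subset_Ioi.2 hR)]
          exact setLIntegral_congr Ioi_ae_eq_Ici.symm
      _ = ENNReal.ofReal (M / R ^ 2 * θ) := by
          rw [setLIntegral_Ioi_inv_cube hM.le hR, ← ENNReal.ofReal_mul (by positivity)]
          congr 1
          field_simp
  refine ⟨?_, fun R hR => ENNReal.toReal_le_of_le_ofReal (by positivity) (htail R hR)⟩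
  refine ENNReal.toReal_le_of_le_ofReal (by positivity) ?_
  have hmR : MeasurableSet {z : Inst 2 | ‖z‖ ≤ 1} :=
    measurableSet_le measurable_norm measurable_const
  have hnear : P (wedge θ ∩ {z | ‖z‖ ≤ 1}) ≤ ENNReal.ofReal (2 * M * θ) := by
    have hm : Measurable ((Iic 1).indicator fun _ : ℝ => ENNReal.ofReal M) :=
      measurable_const.indicator measurableSet_Iic
    calc P (wedge θ ∩ {z | ‖z‖ ≤ 1}) = ∫⁻ z in wedge θ, {z | ‖z‖ ≤ 1}.indicator q z := by
          rw [setLIntegral_indicator hmR, h.eq_withDensity,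
            withDensity_apply _ ((measurableSet_wedge θ).inter hmR), inter_comm]
      _ ≤ ∫⁻ z in wedge θ, (Iic 1).indicator (fun _ : ℝ => ENNReal.ofReal M) ‖z‖ := by
          refine lintegral_mono fun z => ?_
          by_cases hz : ‖z‖ ≤ 1
          · rw [indicator_of_mem (by exact hz), indicator_of_mem (by exact hz)]
            exact (hbound P q h z).1
          · rw [indicator_of_notMem (by exact hz)]
            exact bot_le
      _ = ENNReal.ofReal (2 * θ) * ∫⁻ s in Ioi (0 : ℝ), ENNReal.ofReal s
            * (Iic 1).indicator (fun _ : ℝ => ENNReal.ofReal M) s :=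
          setLIntegral_wedge hθ0 hθ hm
      _ = ENNReal.ofReal (2 * θ) * ∫⁻ s in Ioc (0 : ℝ) 1, ENNReal.ofReal s
            * ENNReal.ofReal M := by
          congr 1
          simp_rw [← indicator_mul_right _ (fun s : ℝ => ENNReal.ofReal s)]
          rw [setLIntegral_indicator measurableSet_Iic, inter_comm, Ioi_inter_Iic]
      _ ≤ ENNReal.ofReal (2 * θ) * ∫⁻ s in Ioc (0 : ℝ) 1, ENNReal.ofReal M := by
          refine mul_le_mul_right (setLIntegral_mono' measurableSet_Ioc fun s hs => ?_) _
          exact mul_le_of_le_one_left bot_le (by simpa using hs.2)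
      _ = ENNReal.ofReal (2 * M * θ) := by
          rw [setLIntegral_const, Real.volume_Ioc, ← ENNReal.ofReal_mul hM.le,
            ← ENNReal.ofReal_mul (by positivity)]
          congr 1
          ring
  calc P (wedge θ) ≤ P (wedge θ ∩ {z | ‖z‖ ≤ 1} ∪ wedge θ ∩ {z | 1 ≤ ‖z‖}) :=
        measure_mono fun z hz => (le_total ‖z‖ 1).imp (fun h => ⟨hz, h⟩) fun h => ⟨hz, h⟩
    _ ≤ ENNReal.ofReal (2 * M * θ) + ENNReal.ofReal (M / 1 ^ 2 * θ) :=
        (measure_union_le _ _).trans (add_le_add hnear (htail 1 one_pos))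
    _ = ENNReal.ofReal (3 * M * θ) := by
        rw [← ENNReal.ofReal_add (by positivity) (by positivity)]
        congr 1
        ring

/-- Opposite halfspaces agree exactly on their common boundary, since sign 0 = +1 for both. This
settles angle π, where no frame of the plane is determined. -/
theorem measure_halfspace_ne_neg {d : ℕ} {P : Measure (Inst d)} [IsProbabilityMeasure P]
    {w w' : UnitVec d} (h : (w : Inst d) = -w')
    (hP : P.real {x | |inner ℝ x (w : Inst d)| ≤ 0} = 0) :
    P.real {x | halfspace w x ≠ halfspace w' x} = 1 := by
  have hm : MeasurableSet {x : Inst d | |inner ℝ x (w : Inst d)| ≤ 0} :=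
    measurableSet_le (by fun_prop) measurable_const
  have e : {x : Inst d | halfspace w x ≠ halfspace w' x}
      = {x | |inner ℝ x (w : Inst d)| ≤ 0}ᶜ := by
    ext x
    simp only [Set.mem_ofPred_eq, halfspace_ne_iff, h, inner_neg_left, inner_neg_right, abs_neg,
      abs_nonpos_iff, Set.mem_compl_iff, real_inner_comm (w' : Inst d) x]
    rcases lt_trichotomy (inner ℝ (w' : Inst d) x : ℝ) 0 with h | h | h
    · simp [h.le, h.not_ge, h.ne]
    · simp [h]
    · simp [h.le, h.not_ge, h.ne']
  rw [e, probReal_compl_eq_one_sub hm, hP, sub_zero]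

/-- Absolute constants for isotropic log-concave distributions exist. -/
theorem exists_valid_constants : ∃ C : Constants, C.Valid := by
  obtain ⟨c, hc, hlow⟩ := exists_wedge_lower_bound
  obtain ⟨M, hM, hup⟩ := exists_wedge_upper_bound
  obtain ⟨B, hB, hband⟩ := exists_band_bound
  have hpi := Real.pi_pos
  -- The bound 1/π handles angle π, where the disagreement is 1; the same term is added to the upper
  -- constant.
  set L := min c (1 / Real.pi) with hL
  have hL0 : 0 < L := by positivity
  -- Chosen so that the tail bound M/T² equals L/8: in the wedge, Tθ ≤ |w·x| ≤ θ‖z‖ forces ‖z‖ ≥ T.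
  set T := Real.sqrt (8 * M / L) with hT
  have hT0 : 0 < T := Real.sqrt_pos.2 (by positivity)
  have hT2 : M / T ^ 2 = L / 8 := by
    rw [hT, Real.sq_sqrt (by positivity)]
    field_simp
  have hpos : ∀ (d : ℕ) (P : Measure (Inst d)), IsIsotropicLogConcave P → ∀ w w' : UnitVec d,
      0 < theta w w' → theta w w' < Real.pi →
      c * theta w w' ≤ P.real {x | halfspace w x ≠ halfspace w' x} ∧
      P.real {x | halfspace w x ≠ halfspace w' x} ≤ 3 * M * theta w w' ∧
      P.real {x | T * theta w w' ≤ |inner ℝ x (w : Inst d)| ∧ halfspace w x ≠ halfspace w' x}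
        ≤ L / 8 * theta w w' := by
    intro d P hP w w' h0 h1
    have := hP.isProbabilityMeasure
    obtain ⟨v, hv, hv1, hvw⟩ := exists_frame h0 h1
    obtain ⟨q, hq⟩ := hP.exists_hasIsotropicDensity
    obtain ⟨q', hq'⟩ := hq.map_coords hv
    have hcm := (continuous_coords v).measurable
    have e : {x | halfspace w x ≠ halfspace w' x} = coords v ⁻¹' wedge (theta w w') := by
      ext x
      exact halfspace_ne_iff_coords_mem_wedge hv1 hvw x
    rw [e, ← map_measureReal_apply hcm (measurableSet_wedge _)]
    have hu := hup _ q' hq' _ h0.le h1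
    refine ⟨hlow _ q' hq' _ h0.le h1, hu.1, ?_⟩
    have hmT : MeasurableSet {z : Inst 2 | T ≤ ‖z‖} :=
      measurableSet_le measurable_const measurable_norm
    rw [← hT2]
    refine le_trans ?_ (hu.2 T hT0)
    rw [map_measureReal_apply hcm ((measurableSet_wedge _).inter hmT)]
    refine measureReal_mono ?_
    rintro x ⟨hx, hx'⟩
    have hxw := (halfspace_ne_iff_coords_mem_wedge hv1 hvw x).1 hx'
    refine ⟨hxw, ?_⟩
    have h2 := abs_coord_le_of_mem_wedge h0.le hxw
    have h3 : (coords v x) 1 = inner ℝ x (w : Inst d) := by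
      simp [coords, hv1, real_inner_comm]
    rw [h3] at h2
    change T ≤ ‖coords v x‖
    nlinarith
  have hends : ∀ (d : ℕ) (P : Measure (Inst d)), IsIsotropicLogConcave P → ∀ w w' : UnitVec d,
      theta w w' = Real.pi → P.real {x | halfspace w x ≠ halfspace w' x} = 1 := by
    intro d P hP w w' h
    have := hP.isProbabilityMeasure
    exact measure_halfspace_ne_neg (eq_neg_of_theta_eq_pi h)
      (le_antisymm (by simpa using hband d P hP w 0 le_rfl) measureReal_nonneg)
  have hcases : ∀ {d : ℕ} (w w' : UnitVec d),
      w = w' ∨ (0 < theta w w' ∧ theta w w' < Real.pi) ∨ theta w w' = Real.pi := by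
    intro d w w'
    rcases (theta_nonneg w w').eq_or_lt with h | h
    · exact Or.inl (eq_of_theta_eq_zero h.symm)
    · rcases (theta_le_pi w w').eq_or_lt with h' | h'
      · exact Or.inr (Or.inr h')
      · exact Or.inr (Or.inl ⟨h, h'⟩)
  have hself : ∀ {d : ℕ} (w : UnitVec d), theta w w = 0 := fun w =>
    angle_self (Metric.ne_of_mem_sphere w.2 one_ne_zero)
  refine ⟨⟨L, 3 * M + 1 / Real.pi, B, T⟩, hL0, by positivity, hB, hT0, ?_, ?_, hband, ?_⟩
  · intro d P hP w w'
    rcases hcases w w' with rfl | ⟨h0, h1⟩ | h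
    · simp [hself]
    · exact (mul_le_mul_of_nonneg_right (min_le_left _ _) h0.le).trans (hpos d P hP w w' h0 h1).1
    · rw [hends d P hP w w' h, h]
      calc L * Real.pi ≤ 1 / Real.pi * Real.pi := by gcongr; exact min_le_right _ _
        _ = 1 := by field_simp
  · intro d P hP w w'
    rcases hcases w w' with rfl | ⟨h0, h1⟩ | h
    · simp [hself]
    · refine (hpos d P hP w w' h0 h1).2.1.trans ?_
      have : 0 ≤ 1 / Real.pi * theta w w' := by positivity
      simp only
      linarith
    · rw [hends d P hP w w' h, h]
      have : 1 / Real.pi * Real.pi = 1 := by field_simp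
      have : 0 < 3 * M * Real.pi := by positivity
      simp only
      linarith
  · intro d P hP w w' α hα hα'
    have := hP.isProbabilityMeasure
    have hα0 : 0 ≤ α := (theta_nonneg w w').trans hα
    simp only
    rcases hcases w w' with rfl | ⟨h0, h1⟩ | h
    · simp only [ne_eq, not_true_eq_false, and_false, Set.ofPred_false, measureReal_empty]
      positivity
    · calc P.real {x | T * α ≤ |inner ℝ x (w : Inst d)| ∧ halfspace w x ≠ halfspace w' x}
          ≤ P.real {x | T * theta w w' ≤ |inner ℝ x (w : Inst d)|
              ∧ halfspace w x ≠ halfspace w' x} :=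
            measureReal_mono fun x hx =>
              ⟨(mul_le_mul_of_nonneg_left hα hT0.le).trans hx.1, hx.2⟩
        _ ≤ L / 8 * theta w w' := (hpos d P hP w w' h0 h1).2.2
        _ ≤ α * (L / 8) := by rw [mul_comm]; gcongr
    · linarith

/-! ### Consequences of bounded noise -/

section BoundedNoise

variable {d : ℕ}

theorem measurable_halfspace (w : UnitVec d) : Measurable (halfspace w) :=
  Measurable.ite (measurableSet_le measurable_const (by fun_prop)) measurable_const
    measurable_const

theorem measurableSet_halfspace_ne (w w' : UnitVec d) :
    MeasurableSet {x | halfspace w x ≠ halfspace w' x} :=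
  (measurableSet_eq_fun (measurable_halfspace w) (measurable_halfspace w')).compl

theorem measurableSet_label_ne (w : UnitVec d) :
    MeasurableSet {p : Example d | p.2 ≠ halfspace w p.1} :=
  (measurableSet_eq_fun measurable_snd ((measurable_halfspace w).comp measurable_fst)).compl

/-- This rewrites the correlation form of the noise condition in terms of the conditional
probability of an error. -/
theorem label_mul_halfspace (w : UnitVec d) (p : Example d) :
    (p.2 : ℝ) * (halfspace w p.1 : ℝ)
      = 1 - 2 * {p : Example d | p.2 ≠ halfspace w p.1}.indicator 1 p := by
  have h1 := p.2.2
  have h2 := (halfspace w p.1).2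
  by_cases h : p.2 = halfspace w p.1
  · rw [Set.indicator_of_notMem (by simpa using h), h]
    rcases h2 with h2 | h2 <;> rw [h2] <;> norm_num
  · rw [Set.indicator_of_mem (by exact h)]
    have h' : (p.2 : ℝ) ≠ halfspace w p.1 := fun h' => h (Subtype.ext h')
    rcases h1 with h1 | h1 <;> rcases h2 with h2 | h2 <;>
      first
      | exact absurd (h1.trans h2.symm) h'
      | (rw [h1, h2]; norm_num)

variable {D : Measure (Example d)} {wstar : UnitVec d} {ν : ℝ}

/-- The `σ`-algebra of the events which depend on the instance only. -/
abbrev instanceSigma (d : ℕ) : MeasurableSpace (Example d) :=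
  MeasurableSpace.comap Prod.fst inferInstance

/-- Under bounded noise, the optimal halfspace errs with conditional probability at most `ν` on
each event that depends on the instance only. -/
theorem HasBoundedNoise.measure_label_ne_le [IsProbabilityMeasure D] (h : HasBoundedNoise D wstar ν)
    {B : Set (Inst d)} (hB : MeasurableSet B) :
    D.real {p | p.1 ∈ B ∧ p.2 ≠ halfspace wstar p.1} ≤ ν * D.real {p | p.1 ∈ B} := by
  have hmle : instanceSigma d ≤ Prod.instMeasurableSpace := measurable_fst.comap_le
  set B' : Set (Example d) := {p | p.1 ∈ B} with hB'
  have hB'm : MeasurableSet[instanceSigma d] B' := ⟨B, hB, rfl⟩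
  have hB'M : MeasurableSet B' := hmle _ hB'm
  set E : Set (Example d) := {p | p.2 ≠ halfspace wstar p.1} with hE
  have hEm : MeasurableSet E := measurableSet_label_ne wstar
  have hf : (fun q : Example d => (q.2 : ℝ) * (halfspace wstar q.1 : ℝ))
      = fun q => 1 - 2 * E.indicator 1 q := funext fun q => label_mul_halfspace wstar q
  have hi : Integrable (E.indicator (1 : Example d → ℝ)) D :=
    (integrable_const (1 : ℝ)).indicator hEm
  have hint : Integrable (fun q : Example d => 1 - 2 * E.indicator (1 : Example d → ℝ) q) D :=
    (integrable_const _).sub (hi.const_mul 2)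
  have h2 := h.2
  rw [hf] at h2
  have h1 := setIntegral_condExp hmle hint hB'm
  have h3 : ∫ q in B', (1 - 2 * E.indicator (1 : Example d → ℝ) q) ∂D
      = D.real B' - 2 * D.real (B' ∩ E) := by
    rw [integral_sub (integrable_const _) (hi.const_mul 2).integrableOn, integral_const_mul,
      integral_indicator_one hEm, measureReal_restrict_apply hEm, Set.inter_comm]
    simp
  have h4 : (1 - 2 * ν) * D.real B'
      ≤ ∫ q in B', (D[fun q : Example d => 1 - 2 * E.indicator (1 : Example d → ℝ) q |
        instanceSigma d]) q ∂D := by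
    have : ∫ _ in B', (1 - 2 * ν) ∂D = (1 - 2 * ν) * D.real B' := by
      simp [mul_comm]
    rw [← this]
    exact integral_mono_ae (integrable_const _) integrable_condExp.integrableOn
      (ae_restrict_of_ae h2)
  rw [h1, h3] at h4
  change D.real (B' ∩ E) ≤ _
  linarith

theorem HasBoundedNoise.nonneg [IsProbabilityMeasure D] (h : HasBoundedNoise D wstar ν) :
    0 ≤ ν := by
  have := h.measure_label_ne_le MeasurableSet.univ
  simp only [Set.mem_univ, true_and, Set.ofPred_true, probReal_univ, mul_one] at this
  exact measureReal_nonneg.trans this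

theorem measurableSet_band (w : UnitVec d) (γ : ℝ) :
    MeasurableSet {p : Example d | |inner ℝ (w : Inst d) p.1| ≤ γ} :=
  measurableSet_le (by fun_prop) measurable_const

theorem bandDist_real_apply [IsFiniteMeasure D] (w : UnitVec d) (γ : ℝ) (s : Set (Example d)) :
    (bandDist D w γ).real s = (D.real {p | |inner ℝ (w : Inst d) p.1| ≤ γ})⁻¹
      * D.real ({p | |inner ℝ (w : Inst d) p.1| ≤ γ} ∩ s) := by
  rw [bandDist, measureReal_def, cond_apply (measurableSet_band w γ), ENNReal.toReal_mul,
    ENNReal.toReal_inv]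
  rfl

/-- A band is an event in x alone, so conditioning on it keeps the noise bound. For a null band the
conditional measure is zero, and ν ≥ 0 suffices. -/
theorem HasBoundedNoise.err_bandDist_le [IsProbabilityMeasure D] (h : HasBoundedNoise D wstar ν)
    (w : UnitVec d) (γ : ℝ) :
    err (bandDist D w γ) wstar ≤ ν := by
  rw [err, bandDist_real_apply]
  have h1 := h.measure_label_ne_le (B := {x | |inner ℝ (w : Inst d) x| ≤ γ})
    (measurableSet_le (by fun_prop) measurable_const)
  refine inv_mul_le_of_le_mul₀ measureReal_nonneg h.nonneg ?_
  rw [mul_comm]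
  exact h1

theorem err_le_err_add_disagreement [IsFiniteMeasure D] (w w' : UnitVec d) :
    err D w ≤ err D w' + disagreement D w w' := by
  refine (measureReal_mono fun p hp => ?_).trans (measureReal_union_le _ _)
  by_cases h : p.2 = halfspace w' p.1
  · exact Or.inr fun h' => hp (h.trans h'.symm)
  · exact Or.inl h

/-- Under bounded noise, the halfspace of `wstar` has the least error. -/
theorem HasBoundedNoise.err_le_err [IsProbabilityMeasure D] (h : HasBoundedNoise D wstar ν)
    (w : UnitVec d) :
    err D wstar ≤ err D w := by
  set W : Set (Example d) := {p | p.1 ∈ {x | halfspace w x ≠ halfspace wstar x}} with hW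
  have hWm : MeasurableSet W := measurable_fst (measurableSet_halfspace_ne w wstar)
  set E : Set (Example d) := {p | p.2 ≠ halfspace wstar p.1} with hE
  have hEm : MeasurableSet E := measurableSet_label_ne wstar
  set F : Set (Example d) := {p | p.2 ≠ halfspace w p.1} with hF
  have h1 : D.real (W ∩ E) ≤ ν * D.real W :=
    h.measure_label_ne_le (measurableSet_halfspace_ne w wstar)
  have h2 : D.real (E ∩ W) + D.real (E \ W) = D.real E := measureReal_inter_add_sdiff hWm
  have h3 : D.real (F ∩ W) + D.real (F \ W) = D.real F := measureReal_inter_add_sdiff hWm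
  have h4 : D.real (W ∩ E) + D.real (W \ E) = D.real W := measureReal_inter_add_sdiff hEm
  -- Off W both halfspaces err together. On W, w errs wherever wstar is right, which is at least the
  -- fraction 1 - ν ≥ ν of W.
  have h5 : E \ W ⊆ F \ W := by
    rintro p ⟨hp, hpW⟩
    have hpW' : halfspace w p.1 = halfspace wstar p.1 := not_not.1 hpW
    exact ⟨fun h' => hp (h'.trans hpW'), hpW⟩
  have h6 : W \ E ⊆ F ∩ W := by
    rintro p ⟨hpW, hp⟩
    have hp' : p.2 = halfspace wstar p.1 := not_not.1 hp
    exact ⟨fun h' => hpW (h'.symm.trans hp'), hpW⟩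
  have h7 := measureReal_mono (μ := D) h5
  have h8 := measureReal_mono (μ := D) h6
  rw [Set.inter_comm] at h2
  change D.real E ≤ D.real F
  nlinarith [h.1, measureReal_nonneg (μ := D) (s := W)]

/-! ### One localization step halves the angle -/

theorem disagreement_eq_map (w w' : UnitVec d) :
    disagreement D w w' = (D.map Prod.fst).real {x | halfspace w x ≠ halfspace w' x} :=
  (map_measureReal_apply measurable_fst (measurableSet_halfspace_ne w w')).symm

theorem theta_comm (w w' : UnitVec d) : theta w w' = theta w' w := angle_comm _ _

theorem theta_eq_arccos (w w' : UnitVec d) :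
    theta w w' = Real.arccos (inner ℝ (w : Inst d) (w' : Inst d)) := by
  rw [← cos_theta, Real.arccos_cos (theta_nonneg _ _) (theta_le_pi _ _)]

/-- Rotating `w` by an angle `t` towards a vector perpendicular to it. -/
theorem exists_theta_eq {w w' : UnitVec d} (h : theta w w' = Real.pi / 2) {t : ℝ} (ht : 0 ≤ t)
    (ht' : t ≤ Real.pi / 2) :
    ∃ u : UnitVec d, theta w u = t ∧ theta u w' = Real.pi / 2 - t := by
  have hpi := Real.pi_pos
  have hw : ‖(w : Inst d)‖ = 1 := by simp
  have hw' : ‖(w' : Inst d)‖ = 1 := by simp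
  have hin : (inner ℝ (w : Inst d) (w' : Inst d) : ℝ) = 0 := by
    rw [← cos_theta, h, Real.cos_pi_div_two]
  have hn : ‖Real.cos t • (w : Inst d) + Real.sin t • (w' : Inst d)‖ = 1 := by
    rw [← sq_eq_sq₀ (norm_nonneg _) zero_le_one, norm_add_sq_real, norm_smul, norm_smul, hw, hw',
      real_inner_smul_left, real_inner_smul_right, hin]
    simp
  refine ⟨⟨Real.cos t • (w : Inst d) + Real.sin t • (w' : Inst d), by simpa using hn⟩, ?_, ?_⟩
  · rw [theta_eq_arccos, inner_add_right, real_inner_smul_right, real_inner_smul_right, hin,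
      real_inner_self_eq_norm_sq, hw]
    simp [Real.arccos_cos ht (by linarith)]
  · rw [theta_eq_arccos, inner_add_left, real_inner_smul_left, real_inner_smul_left, hin,
      real_inner_self_eq_norm_sq, hw', ← Real.cos_pi_div_two_sub]
    simp only [mul_zero, one_pow, mul_one, zero_add]
    exact Real.arccos_cos (by linarith) (by linarith)

namespace Constants.Valid

variable {C : Constants}

theorem C₁lo_theta_le (hC : C.Valid) (hD : IsIsotropicLogConcave (D.map Prod.fst))
    (w w' : UnitVec d) : C.C₁lo * theta w w' ≤ disagreement D w w' := by
  rw [disagreement_eq_map]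
  exact hC.angle_le d _ hD w w'

theorem disagreement_le (hC : C.Valid) (hD : IsIsotropicLogConcave (D.map Prod.fst))
    (w w' : UnitVec d) : disagreement D w w' ≤ C.C₁hi * theta w w' := by
  rw [disagreement_eq_map]
  exact hC.le_angle d _ hD w w'

/-- The bound on the disagreement outside a band, including right angles. -/
theorem outside_le_of_le (hC : C.Valid) {P : Measure (Inst d)} (hP : IsIsotropicLogConcave P)
    {w w' : UnitVec d} {α : ℝ} (h : theta w w' ≤ α) (hα : α ≤ Real.pi / 2) :
    P.real {x | C.C₃' * α ≤ |inner ℝ x (w : Inst d)| ∧ halfspace w x ≠ halfspace w' x}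
      ≤ α * (C.C₁lo / 8) := by
  have := hP.isProbabilityMeasure
  have hpi := Real.pi_pos
  have h3 := hC.C₃'_pos
  have h1 := hC.C₁lo_pos
  have hhi := hC.C₁hi_pos
  -- If the angle is strictly below α it is below π/2, and the bound at the angle itself is
  -- stronger.
  rcases h.lt_or_eq with h0 | h0
  · calc P.real {x | C.C₃' * α ≤ |inner ℝ x (w : Inst d)| ∧ halfspace w x ≠ halfspace w' x}
        ≤ P.real {x | C.C₃' * theta w w' ≤ |inner ℝ x (w : Inst d)|
            ∧ halfspace w x ≠ halfspace w' x} :=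
          measureReal_mono fun x hx => ⟨(mul_le_mul_of_nonneg_left h h3.le).trans hx.1, hx.2⟩
      _ ≤ theta w w' * (C.C₁lo / 8) := hC.outside_le d P hP w w' _ le_rfl (h0.trans_le hα)
      _ ≤ α * (C.C₁lo / 8) := by gcongr
  rcases hα.lt_or_eq with hα' | hα'
  · exact hC.outside_le d P hP w w' α h hα'
  subst hα'
  refine le_of_forall_pos_le_add fun ε hε => ?_
  -- At an exact right angle, w' is replaced by a vector u at angle π/2 - s from w. The disagreement
  -- of u and w' costs at most C₁hi s ≤ ε. This case can occur in the first iteration, where α₁ =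
  -- π/2.
  set s := min (Real.pi / 4) (ε / C.C₁hi) with hs
  have hs0 : 0 < s := by positivity
  have hs1 : s ≤ Real.pi / 4 := min_le_left _ _
  obtain ⟨u, hu, hu'⟩ := exists_theta_eq h0 (t := Real.pi / 2 - s) (by linarith) (by linarith)
  rw [sub_sub_cancel] at hu'
  have hsub : {x | C.C₃' * (Real.pi / 2) ≤ |inner ℝ x (w : Inst d)|
        ∧ halfspace w x ≠ halfspace w' x}
      ⊆ {x | C.C₃' * theta w u ≤ |inner ℝ x (w : Inst d)| ∧ halfspace w x ≠ halfspace u x}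
        ∪ {x | halfspace u x ≠ halfspace w' x} := by
    rintro x ⟨hx, hx'⟩
    by_cases hxu : halfspace u x = halfspace w' x
    · refine Or.inl ⟨le_trans ?_ hx, fun h' => hx' (h'.trans hxu)⟩
      rw [hu]
      gcongr
      linarith
    · exact Or.inr hxu
  calc _ ≤ _ := (measureReal_mono hsub).trans (measureReal_union_le _ _)
    _ ≤ theta w u * (C.C₁lo / 8) + C.C₁hi * theta u w' :=
        add_le_add (hC.outside_le d P hP w u _ le_rfl (by rw [hu]; linarith))
          (hC.le_angle d P hP u w')
    _ ≤ Real.pi / 2 * (C.C₁lo / 8) + ε := by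
        rw [hu, hu']
        refine add_le_add (by gcongr; linarith) ?_
        calc C.C₁hi * s ≤ C.C₁hi * (ε / C.C₁hi) := by gcongr; exact min_le_right _ _
          _ = ε := by field_simp

/-- The two terms in the minimum defining `c₀` answer the two terms in the maximum defining `cγ`. -/
theorem c₀_mul_le (hC : C.Valid) : C.c₀ * (C.C₂hi * C.cγ) ≤ C.C₁lo / 4 := by
  have h1 := hC.C₁lo_pos
  have h2 := hC.C₂hi_pos
  have h3 := hC.C₃'_pos
  unfold cγ
  rcases max_cases C.C₃' (C.C₁lo / C.C₂hi) with ⟨h, _⟩ | ⟨h, _⟩ <;> rw [h]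
  · calc C.c₀ * (C.C₂hi * C.C₃') ≤ C.C₁lo / (4 * C.C₂hi * C.C₃') * (C.C₂hi * C.C₃') := by
          gcongr
          exact min_le_right _ _
      _ = C.C₁lo / 4 := by field_simp
  · calc C.c₀ * (C.C₂hi * (C.C₁lo / C.C₂hi)) ≤ 1 / 4 * (C.C₂hi * (C.C₁lo / C.C₂hi)) := by
          gcongr
          exact min_le_left _ _
      _ = C.C₁lo / 4 := by field_simp

/-- A halfspace near `w` which mostly agrees with `wstar` in the band around `w` makes an angle
with `wstar` at most half of the bound on the angle of `w`. -/
theorem theta_le_half [IsFiniteMeasure D] (hC : C.Valid)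
    (hD : IsIsotropicLogConcave (D.map Prod.fst))
    {w w' : UnitVec d} {α : ℝ} (hw : theta w wstar ≤ α) (hα : α ≤ Real.pi / 2)
    (hw' : theta w' w ≤ α)
    (hband : disagreement (bandDist D w (α * C.cγ)) w' wstar ≤ C.c₀) :
    theta w' wstar ≤ α / 2 := by
  have h1 := hC.C₁lo_pos
  have h2 := hC.C₂hi_pos
  have h3 := hC.C₃'_pos
  have hα0 : 0 ≤ α := (theta_nonneg _ _).trans hw
  have hcγ : C.C₃' ≤ C.cγ := le_max_left _ _
  have hcγ0 : 0 < C.cγ := h3.trans_le hcγ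
  have hc0 : 0 ≤ C.c₀ := le_min (by norm_num) (by positivity)
  set B : Set (Example d) := {p | |inner ℝ (w : Inst d) p.1| ≤ α * C.cγ} with hB
  set S : Set (Example d) := {p | halfspace w' p.1 ≠ halfspace wstar p.1} with hS
  have hBm : MeasurableSet B := measurableSet_band w _
  have hin : D.real (S ∩ B) ≤ α * (C.C₁lo / 4) := by
    have hB1 : D.real B ≤ C.C₂hi * (α * C.cγ) := by
      have := hC.band_le d _ hD w (α * C.cγ) (by positivity)
      rw [map_measureReal_apply measurable_fst
        (measurableSet_le (by fun_prop) measurable_const)] at this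
      simpa only [hB, real_inner_comm, Set.preimage_ofPred_eq] using this
    have hB2 : D.real (B ∩ S) ≤ C.c₀ * D.real B := by
      rw [disagreement, bandDist_real_apply] at hband
      -- For a null band the conditional bound says nothing, but the intersection is null as well.
      rcases (measureReal_nonneg (μ := D) (s := B)).eq_or_lt with h0 | h0
      · rw [← h0, mul_zero, h0]
        exact measureReal_mono Set.inter_subset_left
      · rwa [inv_mul_le_iff₀ h0, mul_comm _ C.c₀] at hband
    rw [Set.inter_comm]
    calc D.real (B ∩ S) ≤ C.c₀ * (C.C₂hi * (α * C.cγ)) := hB2.trans (by gcongr)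
      _ = α * (C.c₀ * (C.C₂hi * C.cγ)) := by ring
      _ ≤ α * (C.C₁lo / 4) := by gcongr; exact hC.c₀_mul_le
  have hout : ∀ u : UnitVec d, theta w u ≤ α →
      D.real {p | C.C₃' * α ≤ |inner ℝ p.1 (w : Inst d)| ∧ halfspace w p.1 ≠ halfspace u p.1}
        ≤ α * (C.C₁lo / 8) := by
    intro u hu
    have := hC.outside_le_of_le hD hu hα
    have hm : MeasurableSet {x : Inst d | C.C₃' * α ≤ |inner ℝ x (w : Inst d)|} :=
      measurableSet_le measurable_const (by fun_prop)
    have hm' : MeasurableSet {x : Inst d | C.C₃' * α ≤ |inner ℝ x (w : Inst d)|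
        ∧ halfspace w x ≠ halfspace u x} := hm.inter (measurableSet_halfspace_ne w u)
    rwa [map_measureReal_apply measurable_fst hm'] at this
  -- If w' and wstar disagree at a point, w disagrees with one of them there; since cγ ≥ C₃', points
  -- off the band are in the range of the outside bound.
  have hsub : S \ B ⊆
      {p | C.C₃' * α ≤ |inner ℝ p.1 (w : Inst d)| ∧ halfspace w p.1 ≠ halfspace w' p.1}
      ∪ {p | C.C₃' * α ≤ |inner ℝ p.1 (w : Inst d)| ∧ halfspace w p.1 ≠ halfspace wstar p.1} := by
    rintro p ⟨hpS, hpB⟩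
    have hge : C.C₃' * α ≤ |inner ℝ p.1 (w : Inst d)| := by
      rw [real_inner_comm]
      refine le_trans ?_ (not_le.1 hpB).le
      rw [mul_comm]
      gcongr
    by_cases h : halfspace w p.1 = halfspace w' p.1
    · exact Or.inr ⟨hge, fun h' => hpS (h.symm.trans h')⟩
    · exact Or.inl ⟨hge, h⟩
  have hS1 : D.real S ≤ α * (C.C₁lo / 2) := by
    have h4 : D.real (S ∩ B) + D.real (S \ B) = D.real S := measureReal_inter_add_sdiff hBm
    have h5 := (measureReal_mono (μ := D) hsub).trans (measureReal_union_le _ _)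
    have h6 := hout w' (by rwa [theta_comm])
    have h7 := hout wstar hw
    linarith
  have h8 : C.C₁lo * theta w' wstar ≤ C.C₁lo * (α / 2) := by
    have := (hC.C₁lo_theta_le hD w' wstar).trans hS1
    linarith
  exact le_of_mul_le_mul_left h8 h1

end Constants.Valid

end BoundedNoise

/-! ### Independent streams and the iteration of the oracle -/

section Algorithm

section Streams

variable {X : Type*} [MeasurableSpace X]

/-- The first `s` entries of an i.i.d. stream and the block of the next `m` entries are
independent samples. -/
theorem measurePreserving_prefix_block (μ : Measure X) [IsProbabilityMeasure μ] (s m : ℕ) :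
    MeasurePreserving
      (fun S : ℕ → X => ((fun i : Fin s => S i), fun j : Fin m => S (s + j)))
      (Measure.infinitePi fun _ => μ)
      ((Measure.pi fun _ => μ).prod (Measure.pi fun _ => μ)) := by
  let e : Fin s ⊕ Fin m → ℕ := Sum.elim (fun i => i) fun j => s + j
  have he : Function.Injective e := by
    rintro (i | i) (j | j) h
    · exact congrArg Sum.inl (Fin.ext h)
    · have := i.2
      simp only [e, Sum.elim_inl, Sum.elim_inr] at h
      omega
    · have := j.2
      simp only [e, Sum.elim_inl, Sum.elim_inr] at h
      omega
    · simp only [e, Sum.elim_inr] at h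
      exact congrArg Sum.inr (Fin.ext (by omega))
  have h1 : MeasurePreserving (fun (S : ℕ → X) i => S (e i)) (Measure.infinitePi fun _ => μ)
      (Measure.pi fun _ => μ) := by
    refine ⟨by fun_prop, ?_⟩
    rw [← Measure.infinitePi_eq_pi]
    exact Measure.map_infinitePi_infinitePi_of_inj (P := fun _ => μ) he
  exact (measurePreserving_sumPiEquivProdPi fun _ : Fin s ⊕ Fin m => μ).comp h1

/-- The first `k` entries of an i.i.d. stream and the next entry are independent. -/
theorem measurePreserving_prefix_next (μ : Measure X) [IsProbabilityMeasure μ] (k : ℕ) :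
    MeasurePreserving (fun S : ℕ → X => ((fun i : Fin k => S i), S k))
      (Measure.infinitePi fun _ => μ) ((Measure.pi fun _ => μ).prod μ) :=
  ((MeasurePreserving.id (Measure.pi fun _ : Fin k => μ)).prod
    (measurePreserving_funUnique μ (Fin 1))).comp (measurePreserving_prefix_block μ k 1)

/-- Regroups (past examples, next block) and (past seeds, next seed) into past and fresh randomness.
-/
theorem measurePreserving_prod_prod_comm {A B C E : Type*} [MeasurableSpace A] [MeasurableSpace B]
    [MeasurableSpace C] [MeasurableSpace E] (a : Measure A) (b : Measure B) (c : Measure C)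
    (e : Measure E) [SFinite a] [SFinite b] [SFinite c] [SFinite e] :
    MeasurePreserving (fun p : (A × B) × C × E => ((p.1.1, p.2.1), (p.1.2, p.2.2)))
      ((a.prod b).prod (c.prod e)) ((a.prod c).prod (b.prod e)) := by
  have h1 := measurePreserving_prodAssoc a b (c.prod e)
  have h2 := (MeasurePreserving.id a).prod ((measurePreserving_prodAssoc b c e).symm)
  have h3 := (MeasurePreserving.id a).prod
    ((Measure.measurePreserving_swap (μ := b) (ν := c)).prod (MeasurePreserving.id e))
  have h4 := (MeasurePreserving.id a).prod (measurePreserving_prodAssoc c b e)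
  have h5 := (measurePreserving_prodAssoc a c (b.prod e)).symm
  exact h5.comp (h4.comp (h3.comp (h2.comp h1)))

/-- If each point of `G` satisfies `H` with conditional probability at least `1 - η`, then `H`
is at most `η` less likely than `G`. -/
theorem measureReal_sub_le_prod {Y : Type*} [MeasurableSpace Y] {μ : Measure X} {ν : Measure Y}
    [IsProbabilityMeasure μ] [IsProbabilityMeasure ν] {G : Set X} {H : Set (X × Y)}
    (hG : MeasurableSet G) (hH : MeasurableSet H) {η : ℝ} (hη : 0 ≤ η)
    (h : ∀ x ∈ G, 1 - η ≤ ν.real {y | (x, y) ∈ H}) :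
    μ.real G - η ≤ (μ.prod ν).real H := by
  have h1 : ENNReal.ofReal (μ.real G * (1 - η)) ≤ (μ.prod ν) H := by
    rw [Measure.prod_apply hH, ENNReal.ofReal_mul measureReal_nonneg, ofReal_measureReal, mul_comm,
      ← setLIntegral_const]
    refine (setLIntegral_mono' hG fun x hx => ?_).trans (setLIntegral_le_lintegral G _)
    exact (ENNReal.ofReal_le_ofReal (h x hx)).trans_eq (ofReal_measureReal)
  have h2 := (ENNReal.ofReal_le_iff_le_toReal (measure_ne_top _ _)).1 h1
  have h3 : μ.real G ≤ 1 := measureReal_le_one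
  refine le_trans ?_ h2
  nlinarith

/-- Extension of a finite sequence by a constant value. -/
def extend (x₀ : X) {s : ℕ} (x : Fin s → X) (i : ℕ) : X := if h : i < s then x ⟨i, h⟩ else x₀

theorem measurable_extend (x₀ : X) (s : ℕ) : Measurable (extend x₀ (s := s)) := by
  refine measurable_pi_lambda _ fun i => ?_
  unfold extend
  split_ifs with h
  · exact measurable_pi_apply _
  · exact measurable_const

end Streams

variable {d : ℕ} {C : Constants} {O : Oracle d} {w₁ wstar : UnitVec d} {δ' : ℝ}

theorem measurable_theta (w : UnitVec d) : Measurable fun u : UnitVec d => theta u w := by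
  simp_rw [theta_eq_arccos]
  exact Real.continuous_arccos.measurable.comp (by fun_prop)

/-- The number of examples read in the first `k` iterations. -/
def samplesUpTo (C : Constants) (O : Oracle d) (δ' : ℝ) (k : ℕ) : ℕ :=
  ∑ j ∈ Finset.Icc 1 k, O.numSamples (C.γ j) (αk j) δ'

theorem localize_snd (S : ℕ → Example d) (ω : ℕ → unitInterval) (k : ℕ) :
    (localize C O w₁ δ' S ω k).2 = samplesUpTo C O δ' k := by
  induction k with
  | zero => rfl
  | succ k ih =>
    rw [samplesUpTo, Finset.sum_Icc_succ_top (by omega), ← samplesUpTo, ← ih]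
    rfl

theorem localize_succ_fst (S : ℕ → Example d) (ω : ℕ → unitInterval) (k : ℕ) :
    (localize C O w₁ δ' S ω (k + 1)).1 = O.run (localize C O w₁ δ' S ω k).1 (C.γ (k + 1))
      (αk (k + 1)) δ' (fun i => S (samplesUpTo C O δ' k + i)) (ω k) := by
  rw [← localize_snd (w₁ := w₁) S ω k]
  rfl

/-- The block sizes do not depend on the data, so the current vector is a function of a prefix of
fixed length. This makes it independent of the next block. -/
theorem localize_congr {S S' : ℕ → Example d} {ω ω' : ℕ → unitInterval} (k : ℕ)
    (hS : ∀ i < samplesUpTo C O δ' k, S i = S' i) (hω : ∀ i < k, ω i = ω' i) :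
    (localize C O w₁ δ' S ω k).1 = (localize C O w₁ δ' S' ω' k).1 := by
  induction k with
  | zero => rfl
  | succ k ih =>
    have e : samplesUpTo C O δ' (k + 1)
        = samplesUpTo C O δ' k + O.numSamples (C.γ (k + 1)) (αk (k + 1)) δ' :=
      Finset.sum_Icc_succ_top (by omega) _
    rw [localize_succ_fst, localize_succ_fst,
      ih (fun i hi => hS i (by omega)) fun i hi => hω i (by omega), hω k (by omega)]
    congr 1
    ext1 i
    exact hS _ (by have := i.2; omega)

theorem measurable_localize (k : ℕ) :
    Measurable fun q : (ℕ → Example d) × (ℕ → unitInterval) =>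
      (localize C O w₁ δ' q.1 q.2 k).1 := by
  induction k with
  | zero => exact measurable_const
  | succ k ih =>
    simp_rw [localize_succ_fst]
    have h1 : Measurable fun q : (ℕ → Example d) × (ℕ → unitInterval) =>
        fun i : Fin (O.numSamples (C.γ (k + 1)) (αk (k + 1)) δ') =>
          q.1 (samplesUpTo C O δ' k + i) := by fun_prop
    have h2 : Measurable fun q : (ℕ → Example d) × (ℕ → unitInterval) => q.2 k := by fun_prop
    exact (O.measurable_run _ _ _).comp (ih.prodMk (h1.prodMk h2))

theorem αk_succ (k : ℕ) : αk (k + 1) = αk k / 2 := by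
  unfold αk
  ring

theorem αk_succ_le (k : ℕ) : αk (k + 1) ≤ Real.pi / 2 := by
  have h : (1 / 2 : ℝ) ^ k ≤ 1 := pow_le_one₀ (by norm_num) (by norm_num)
  have := Real.pi_pos
  rw [αk_succ, αk]
  nlinarith

variable {D : Measure (Example d)} [IsProbabilityMeasure D] {ν tol : ℝ}

/-- One oracle call halves the bound on the angle with probability at least `1 - δ'`. -/
theorem Oracle.Succeeds.theta_le (hC : C.Valid) (hD : IsIsotropicLogConcave (D.map Prod.fst))
    (hν : HasBoundedNoise D wstar ν) (hg : ν ≤ tol) {k : ℕ}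
    (hO : O.Succeeds D wstar tol C.c₀ (C.γ (k + 1)) (αk (k + 1)) δ') {w : UnitVec d}
    (hw : theta w wstar ≤ αk (k + 1)) :
    1 - δ' ≤ ((Measure.pi fun _ => D).prod (volume : Measure unitInterval)).real
      {q | theta (O.run w (C.γ (k + 1)) (αk (k + 1)) δ' q.1 q.2) wstar ≤ αk (k + 2)} := by
  obtain ⟨h1, h2⟩ := hO w hw ((hν.err_bandDist_le w _).trans hg)
  refine h2.trans (ENNReal.toReal_mono (measure_ne_top _ _) (measure_mono_ae ?_))
  filter_upwards [h1] with q hq hq'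
  change _ ≤ αk (k + 1 + 1)
  rw [αk_succ (k + 1)]
  exact hC.theta_le_half hD hw (αk_succ_le k) hq hq'

/-- The angle bound holds after `k` iterations with probability at least `1 - k δ'`. -/
theorem one_sub_le_streams_theta (hC : C.Valid) (hD : IsIsotropicLogConcave (D.map Prod.fst))
    (hν : HasBoundedNoise D wstar ν) (hg : ν ≤ tol) (hδ : 0 ≤ δ')
    (h₁ : theta w₁ wstar ≤ αk 1) {r : ℕ}
    (hO : ∀ k < r, O.Succeeds D wstar tol C.c₀ (C.γ (k + 1)) (αk (k + 1)) δ') :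
    ∀ k ≤ r, 1 - k * δ' ≤ (streams D).real
      {q | theta (localize C O w₁ δ' q.1 q.2 k).1 wstar ≤ αk (k + 1)} := by
  intro k
  induction k with
  | zero =>
    intro _
    have : {q : (ℕ → Example d) × (ℕ → unitInterval) |
        theta (localize C O w₁ δ' q.1 q.2 0).1 wstar ≤ αk (0 + 1)} = Set.univ :=
      Set.eq_univ_of_forall fun _ => h₁
    have hs : IsProbabilityMeasure (streams D) := by unfold streams; infer_instance
    rw [this, probReal_univ]
    simp
  | succ k ih =>
    intro hk
    set s := samplesUpTo C O δ' k with hs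
    set m := O.numSamples (C.γ (k + 1)) (αk (k + 1)) δ' with hm
    -- An arbitrary value padding the finite prefix to a stream; by `localize_congr` it has no
    -- influence.
    let x₀ : Example d := (0, ⟨1, Or.inl rfl⟩)
    let W : (Fin s → Example d) × (Fin k → unitInterval) → UnitVec d := fun p =>
      (localize C O w₁ δ' (extend x₀ p.1) (extend 0 p.2) k).1
    have hW : Measurable W := (measurable_localize k).comp
      (((measurable_extend x₀ s).comp measurable_fst).prodMk
        ((measurable_extend 0 k).comp measurable_snd))
    have hWeq : ∀ (S : ℕ → Example d) (ω : ℕ → unitInterval),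
        (localize C O w₁ δ' S ω k).1 = W (fun i => S i, fun i => ω i) := by
      intro S ω
      refine localize_congr k (fun i hi => ?_) fun i hi => ?_
      · simp [extend, show i < s from hi]
      · simp [extend, hi]
    have hmp : MeasurePreserving
        (fun q : (ℕ → Example d) × (ℕ → unitInterval) =>
          (((fun i : Fin s => q.1 i), (fun i : Fin k => q.2 i)),
            ((fun j : Fin m => q.1 (s + j)), q.2 k)))
        (streams D)
        (((Measure.pi fun _ => D).prod (Measure.pi fun _ => (volume : Measure unitInterval))).prod
          ((Measure.pi fun _ => D).prod (volume : Measure unitInterval))) := by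
      have e1 := measurePreserving_prefix_block D s m
      have e2 := measurePreserving_prefix_next (volume : Measure unitInterval) k
      have e3 := measurePreserving_prod_prod_comm (Measure.pi fun _ : Fin s => D)
        (Measure.pi fun _ : Fin m => D)
        (Measure.pi fun _ : Fin k => (volume : Measure unitInterval))
        (volume : Measure unitInterval)
      exact e3.comp (e1.prod e2)
    set G : Set ((Fin s → Example d) × (Fin k → unitInterval)) :=
      {p | theta (W p) wstar ≤ αk (k + 1)} with hG
    have hGm : MeasurableSet G :=
      measurableSet_le ((measurable_theta wstar).comp hW) measurable_const
    set H : Set (((Fin s → Example d) × (Fin k → unitInterval)) ×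
        ((Fin m → Example d) × unitInterval)) :=
      {p | theta (O.run (W p.1) (C.γ (k + 1)) (αk (k + 1)) δ' p.2.1 p.2.2) wstar ≤ αk (k + 2)}
      with hH
    have hHm : MeasurableSet H :=
      measurableSet_le ((measurable_theta wstar).comp ((O.measurable_run _ _ _).comp
        ((hW.comp measurable_fst).prodMk measurable_snd))) measurable_const
    -- With the past p fixed, the input vector is deterministic, so the oracle guarantee applies to
    -- the fresh block alone.
    have hstep : ∀ p ∈ G, 1 - δ' ≤ ((Measure.pi fun _ : Fin m => D).prod
        (volume : Measure unitInterval)).real {y | (p, y) ∈ H} := fun p hp =>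
      (hO k (by omega)).theta_le (w := W p) hC hD hν hg hp
    have key := measureReal_sub_le_prod
      (μ := (Measure.pi fun _ : Fin s => D).prod
        (Measure.pi fun _ : Fin k => (volume : Measure unitInterval))) hGm hHm hδ hstep
    have hGeq := hmp.measureReal_preimage (hGm.prod MeasurableSet.univ).nullMeasurableSet
    rw [measureReal_prod_prod, probReal_univ, mul_one] at hGeq
    rw [← hGeq, ← hmp.measureReal_preimage hHm.nullMeasurableSet] at key
    have hi := ih (by omega)
    simp_rw [localize_succ_fst, hWeq] at hi ⊢
    have e1 : (fun q : (ℕ → Example d) × (ℕ → unitInterval) =>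
          (((fun i : Fin s => q.1 i), (fun i : Fin k => q.2 i)),
            ((fun j : Fin m => q.1 (s + j)), q.2 k))) ⁻¹' (G ×ˢ Set.univ)
        = {q | theta (W (fun i => q.1 i, fun i => q.2 i)) wstar ≤ αk (k + 1)} := by
      ext q
      simp [hG]
    rw [e1] at key
    refine le_trans ?_ key
    push_cast
    linarith

end Algorithm

end Localization

end

/-! ### Sample count and error guarantee of the algorithm -/

theorem mainTheorem8 :
    (∃ C : Localization.Constants, C.Valid) ∧
    ∀ C : Localization.Constants, C.Valid →
      ∀ (d : ℕ) (O : Localization.Oracle d) (g : ℝ → ℝ)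
        (D : Measure (Localization.Example d)) [IsProbabilityMeasure D]
        (wstar w₁ : Localization.UnitVec d) (ν ε δ : ℝ),
        Localization.IsIsotropicLogConcave (D.map Prod.fst) →
        Localization.HasBoundedNoise D wstar ν →
        ν ≤ g C.c₀ →
        0 < ε → 0 < δ → δ < 1 →
        Localization.theta w₁ wstar < Real.pi / 2 →
        (∀ k ∈ Finset.Icc 1 (C.iterations ε),
          O.Succeeds D wstar (g C.c₀) C.c₀ (C.γ k) (Localization.αk k)
            (δ / C.iterations ε)) →
        (∀ (S : ℕ → Localization.Example d) (ω : ℕ → unitInterval),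
          (Localization.localization C O w₁ ε δ S ω).2 =
            ∑ k ∈ Finset.Icc 1 (C.iterations ε),
              O.numSamples (C.γ k) (Localization.αk k) (δ / C.iterations ε)) ∧
        1 - δ ≤ (Localization.streams D).real
          {q | Localization.err D (Localization.localization C O w₁ ε δ q.1 q.2).1
            ≤ Localization.opt D + ε} := by
  refine ⟨Localization.exists_valid_constants, ?_⟩
  intro C hC d O g D _ wstar w₁ ν ε δ hD hν hg hε hδ _ h₁ hO
  refine ⟨fun S ω => Localization.localize_snd S ω _, ?_⟩
  set r := C.iterations ε with hr
  have hhi := hC.C₁hi_pos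
  have hpi := Real.pi_pos
  have hα1 : Localization.αk 1 = Real.pi / 2 := by
    unfold Localization.αk
    ring
  have key := Localization.one_sub_le_streams_theta hC hD hν hg
    (div_nonneg hδ.le (Nat.cast_nonneg r)) (hα1 ▸ h₁.le) (r := r)
    (fun k hk => hO (k + 1) (Finset.mem_Icc.2 ⟨by omega, by omega⟩)) r le_rfl
  -- Only an inequality, since the left side is 0 when there are no iterations.
  have hrδ : (r : ℝ) * (δ / r) ≤ δ := by
    rcases r.eq_zero_or_pos with h | h
    · simp [h, hδ.le]
    · have : (0 : ℝ) < r := by exact_mod_cast h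
      rw [mul_div_cancel₀ _ this.ne']
  have hs : IsProbabilityMeasure (Localization.streams D) := by
    unfold Localization.streams
    infer_instance
  refine le_trans (by linarith) (key.trans (measureReal_mono fun q hq => ?_))
  have hopt : Localization.err D wstar ≤ Localization.opt D :=
    haveI : Nonempty (Localization.UnitVec d) := ⟨wstar⟩
    le_ciInf fun w => hν.err_le_err w
  have hlast : C.C₁hi * Localization.αk (r + 1) ≤ ε := by
    -- The subtraction in r is truncated, but the ceiling is at most r + 1 in either case. This also
    -- covers r = 0, where the initial angle is already small enough.
    have h2 : Real.logb 2 (C.C₁hi * Real.pi / ε) ≤ ((r + 1 : ℕ) : ℝ) := by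
      refine (Nat.le_ceil _).trans (Nat.cast_le.2 ?_)
      rw [hr, Localization.Constants.iterations]
      omega
    rw [Real.logb_le_iff_le_rpow (by norm_num) (by positivity), Real.rpow_natCast,
      div_le_iff₀ hε] at h2
    rw [Localization.αk, one_div, inv_pow, ← mul_assoc, mul_right_comm, ← div_eq_mul_inv,
      div_le_iff₀ (by positivity), mul_comm ε]
    exact h2
  have h3 := Localization.err_le_err_add_disagreement (D := D)
    (Localization.localization C O w₁ ε δ q.1 q.2).1 wstar
  have h4 := hC.disagreement_le hD (Localization.localization C O w₁ ε δ q.1 q.2).1 wstar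
  have h5 := mul_le_mul_of_nonneg_left (show Localization.theta
    (Localization.localization C O w₁ ε δ q.1 q.2).1 wstar ≤ Localization.αk (r + 1) from hq) hhi.le
  rw [Set.mem_ofPred_eq]
  linarith
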